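/- Let $d\in\mathbb N$. For $f\in\mathcal S'(\mathbb R^{n})$ and a window $g\in\mathcal S(\mathbb R^{n})\setminus\{0\}$ let $V_gf(x,\omega)=\langle f,\pi(x,\omega)g\rangle$, where $\pi(x,\omega)g(t)=e^{2\pi i\omega\cdot t}g(t-x)$ and $\langle\cdot,\cdot\rangle$ is the duality bracket between $\mathcal S'$ and $\mathcal S$ that extends $\int f\overline g$ (conjugate-linear in the second argument). For $1\le p,q\le\infty$ the modulation space $M^{p,q}(\mathbb R^n)$ and the Wiener amalgam space $W(\mathcal FL^p,L^q)(\mathbb R^n)$ consist of the $f\in\mathcal S'(\mathbb R^n)$ for which, respectively, $$\|f\|_{M^{p,q}}=\Big\|\,\omega\mapsto\|V_gf(\cdot,\omega)\|_{L^p}\Big\|_{L^q}<\infty,\qquad \|f\|_{W(\mathcal FL^p,L^q)}=\Big\|\,x\mapsto\|V_gf(x,\cdot)\|_{L^p}\Big\|_{L^q}<\infty ,$$ where $g$ is any fixed nonzero Schwartz window. For $\tau\in[0,1]$ and $f,g\in\mathcal S(\mathbb R^d)$ let $$W_\tau(f,g)(x,\omega)=\int_{\mathbb R^d}e^{-2\pi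 i y\cdot\omega}f(x+\tau y)\,\overline{g(x-(1-\tau)y)}\,dy ,$$ and for $\sigma\in\mathcal S'(\mathbb R^{2d})$ let $\mathrm{Op}_\tau(\sigma):\mathcal S(\mathbb R^d)\to\mathcal S'(\mathbb R^d)$ be defined by $\langle\mathrm{Op}_\tau(\sigma)f,g\rangle=\langle\sigma,W_\tau(g,f)\rangle$. Assume $\sigma\in W(\mathcal FL^\infty,L^1)(\mathbb R^{2d})$. Then: 1. The Kohn–Nirenberg operator $\mathrm{Op}_0(\sigma)$ is bounded on $M^{1,\infty}(\mathbb R^d)$. 2. The anti-Kohn–Nirenberg operator $\mathrm{Op}_1(\sigma)$ is bounded on $W(\mathcal FL^1,L^\infty)(\mathbb R^d)$. Here "$A=\mathrm{Op}_\tau(\sigma)$ is bounded on $X$" means: $\mathcal S(\mathbb R^d)\subset X$, and there is a linear map $T:X\to X$ with $Tf=Af$ for all $f\in\mathcal S(\mathbb R^d)$ and $\|Tf\|_X\le C\|f\|_X$ for all $f\in X$, with $C$ independent of $f$, which is the canonical extension of $A$: for all $f\in X$, $h\in\mathcal S(\mathbb R^d)$ and every $g\in\mathcal S(\mathbb R^d)\setminus\{0\}$,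 $$\langle Tf,h\rangle=\frac1{\|g\|_2^2}\int_{\mathbb R^{2d}}V_gf(z)\,\langle A\,\pi(z)g,h\rangle\,dz$$ with an absolutely convergent integral. -/

import Mathlib

open MeasureTheory SchwartzMap FourierTransform
open scoped ENNReal NNReal InnerProductSpace SchwartzMap ComplexConjugate

noncomputable section

namespace TimeFrequency

/-! ### Time-frequency shifts and the short-time Fourier transform -/

section STFT

variable {V : Type*} [NormedAddCommGroup V] [InnerProductSpace ℝ V]

/-- The function `s ↦ e^{2πis}` on the real line. -/
def expi (s : ℝ) : ℂ := Complex.exp ((2 * Real.pi * s : ℝ) * Complex.I)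

theorem norm_expi (s : ℝ) : ‖expi s‖ = 1 := Complex.norm_exp_ofReal_mul_I _

theorem expi_hasTemperateGrowth : Function.HasTemperateGrowth expi := by
  have hfun : expi = fun s : ℝ => Complex.exp ((2 * Real.pi * Complex.I) * (s : ℂ)) := by
    funext s
    simp only [expi]
    congr 1
    push_cast
    ring
  have hd : ∀ n : ℕ, iteratedDeriv n expi
      = fun s : ℝ => (2 * Real.pi * Complex.I) ^ n * expi s := by
    intro n
    induction n with
    | zero => simp
    | succ n ih =>
      rw [iteratedDeriv_succ, ih]
      funext s
      have h1 : HasDerivAt expi ((2 * Real.pi * Complex.I) * expi s) s := by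
        rw [hfun]
        have h2 : HasDerivAt (fun s : ℝ => (2 * Real.pi * Complex.I) * (s : ℂ))
            ((2 * Real.pi * Complex.I) * 1) s :=
          (Complex.ofRealCLM.hasDerivAt (x := s)).const_mul _
        have h3 := h2.cexp
        convert h3 using 1
        ring
      rw [(h1.const_mul _).deriv]
      ring
  refine ⟨?_, fun n => ⟨0, (2 * Real.pi) ^ n, fun s => ?_⟩⟩
  · rw [hfun]
    exact Complex.contDiff_exp.comp (contDiff_const.mul Complex.ofRealCLM.contDiff)
  · rw [norm_iteratedFDeriv_eq_norm_iteratedDeriv, hd n]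
    simp [norm_expi, abs_of_pos Real.pi_pos]

theorem expi_inner_hasTemperateGrowth (ω : V) :
    Function.HasTemperateGrowth (fun t : V => expi ⟪ω, t⟫_ℝ) :=
  expi_hasTemperateGrowth.comp (innerSL ℝ ω).hasTemperateGrowth

/-- The complex conjugate of a Schwartz function. -/
def conjS (g : 𝓢(V, ℂ)) : 𝓢(V, ℂ) :=
  SchwartzMap.postcompCLM (𝕜 := ℝ) (Complex.conjCLE : ℂ →L[ℝ] ℂ) g

@[simp]
theorem conjS_apply (g : 𝓢(V, ℂ)) (t : V) : conjS g t = conj (g t) := rfl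

/-- The bracket `⟨f, g⟩` between a tempered distribution and a Schwartz function,
conjugate-linear in the second argument: it extends `∫ f(t) conj (g(t)) dt`. -/
def bracket (f : 𝓢'(V, ℂ)) (g : 𝓢(V, ℂ)) : ℂ := f (conjS g)

/-- The time-frequency shift `π(x, ω) g (t) = e^{2πi ω·t} g(t - x)`. -/
def tfShift (x ω : V) (g : 𝓢(V, ℂ)) : 𝓢(V, ℂ) :=
  SchwartzMap.smulLeftCLM ℂ (fun t : V => expi ⟪ω, t⟫_ℝ) (SchwartzMap.compSubConstCLM ℂ x g)

theorem tfShift_apply (x ω : V) (g : 𝓢(V, ℂ)) (t : V) :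
    tfShift x ω g t = expi ⟪ω, t⟫_ℝ * g (t - x) := by
  rw [tfShift, SchwartzMap.smulLeftCLM_apply_apply (expi_inner_hasTemperateGrowth ω),
    SchwartzMap.compSubConstCLM_apply, smul_eq_mul]

/-- The short-time Fourier transform `V_g f (x, ω) = ⟨f, π(x, ω) g⟩`. -/
def stft (g : 𝓢(V, ℂ)) (f : 𝓢'(V, ℂ)) (x ω : V) : ℂ := bracket f (tfShift x ω g)

variable [FiniteDimensional ℝ V] [MeasurableSpace V] [BorelSpace V]

/-- The norm of the modulation space `M^{p,q}` computed with the window `g`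
(the value `∞` is allowed): the inner norm is in the time variable `x`,
the outer norm in the frequency variable `ω`. -/
def modulationNorm (g : 𝓢(V, ℂ)) (p q : ℝ≥0∞) (f : 𝓢'(V, ℂ)) : ℝ≥0∞ :=
  eLpNorm (fun ω : V => eLpNorm (fun x : V => stft g f x ω) p volume) q volume

/-- The norm of the Wiener amalgam space `W(𝓕L^p, L^q)` computed with the window `g`
(the value `∞` is allowed): the inner norm is in the frequency variable `ω`,
the outer norm in the time variable `x`. -/
def wienerAmalgamNorm (g : 𝓢(V, ℂ)) (p q : ℝ≥0∞) (f : 𝓢'(V, ℂ)) : ℝ≥0∞ :=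
  eLpNorm (fun x : V => eLpNorm (fun ω : V => stft g f x ω) p volume) q volume

/-- The Wiener amalgam space `W(𝓕L^p, L^q)`, defined with the window `g`. -/
def wienerAmalgamSpace (g : 𝓢(V, ℂ)) (p q : ℝ≥0∞) : Set 𝓢'(V, ℂ) :=
  {f | wienerAmalgamNorm g p q f < ∞}

/-- `u` is the image of the tempered distribution `f` under the operator
`A : 𝓢 → 𝓢'`, extended to distributions by expanding `f` in time-frequency shifts,
`f = ‖g‖₂⁻² ∫ V_g f(z) π(z)g dz`:
for every nonzero window `g` and every Schwartz function `h` one has the absolutely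
convergent weak integral `⟨u, h⟩ = ‖g‖₂⁻² ∫ V_g f(z) ⟨A π(z)g, h⟩ dz`.
There is at most one such `u`. -/
def IsImage (A : 𝓢(V, ℂ) → 𝓢'(V, ℂ)) (f u : 𝓢'(V, ℂ)) : Prop :=
  ∀ g : 𝓢(V, ℂ), g ≠ 0 → ∀ h : 𝓢(V, ℂ),
    Integrable (fun z : V × V => stft g f z.1 z.2 * bracket (A (tfShift z.1 z.2 g)) h) ∧
    bracket u h = ((∫ t : V, ‖g t‖ ^ 2 : ℝ) : ℂ)⁻¹ *
      ∫ z : V × V, stft g f z.1 z.2 * bracket (A (tfShift z.1 z.2 g)) h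

/-- `T` is the bounded linear operator induced by `A : 𝓢 → 𝓢'` on the space
`{f ∈ 𝓢' : N f < ∞}` with norm `N`. The values of `T` outside this space are irrelevant. -/
structure IsBoundedOperator (A : 𝓢(V, ℂ) → 𝓢'(V, ℂ)) (N : 𝓢'(V, ℂ) → ℝ≥0∞)
    (T : 𝓢'(V, ℂ) → 𝓢'(V, ℂ)) : Prop where
  /-- Schwartz functions lie in the space, and `T` agrees with `A` on them. -/
  extends_schwartz : ∀ f : 𝓢(V, ℂ), N (f : 𝓢'(V, ℂ)) < ∞ ∧ T (f : 𝓢'(V, ℂ)) = A f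
  /-- On the whole space `T` is given by the canonical extension of `A`. -/
  isImage : ∀ f, N f < ∞ → IsImage A f (T f)
  map_add : ∀ f₁ f₂, N f₁ < ∞ → N f₂ < ∞ → T (f₁ + f₂) = T f₁ + T f₂
  map_smul : ∀ (c : ℂ) (f), N f < ∞ → T (c • f) = c • T f
  bounded : ∃ C : ℝ≥0, ∀ f, N f < ∞ → N (T f) ≤ C * N f

end STFT

/-! ### Wigner distributions and pseudodifferential operators -/

/-- The Euclidean space `ℝ^d`. -/
abbrev Space (d : ℕ) : Type := EuclideanSpace ℝ (Fin d)

/-- The phase space `ℝ^{2d}`, with points `(x, ω)` and its Euclidean structure. -/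
abbrev PhaseSpace (d : ℕ) : Type := WithLp 2 (Space d × Space d)

variable {d : ℕ}

/-- The cross-`τ`-Wigner distribution
`W_τ(f, g)(x, ω) = ∫ e^{-2πi y·ω} f(x + τy) conj (g(x - (1-τ)y)) dy`. -/
def tauWigner (τ : ℝ) (f g : 𝓢(Space d, ℂ)) (z : PhaseSpace d) : ℂ :=
  ∫ y : Space d, expi (-⟪y, z.snd⟫_ℝ) * f (z.fst + τ • y) * conj (g (z.fst - (1 - τ) • y))

theorem norm_iteratedFDeriv_comp_fst_le (f : 𝓢(Space d, ℂ)) (i : ℕ) (z : PhaseSpace d) :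
    ‖iteratedFDeriv ℝ i (fun z : PhaseSpace d => f z.fst) z‖ ≤ ‖iteratedFDeriv ℝ i f z.fst‖ := by
  let L : PhaseSpace d →L[ℝ] Space d := WithLp.fstL 2 ℝ (Space d) (Space d)
  have hL : ‖L‖ ≤ 1 := L.opNorm_le_bound zero_le_one fun z => by
    simpa [L] using WithLp.norm_fst_le _ z
  have h := L.iteratedFDeriv_comp_right (f.smooth ⊤) z (i := i) (mod_cast le_top)
  have h' : (f ∘ L) = fun z : PhaseSpace d => f z.fst := rfl
  rw [← h', h]
  refine (ContinuousMultilinearMap.norm_compContinuousLinearMap_le _ _).trans ?_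
  refine mul_le_of_le_one_right (norm_nonneg _) ?_
  exact Finset.prod_le_one (fun _ _ => norm_nonneg _) fun _ _ => hL

theorem norm_iteratedFDeriv_comp_snd_le (f : 𝓢(Space d, ℂ)) (i : ℕ) (z : PhaseSpace d) :
    ‖iteratedFDeriv ℝ i (fun z : PhaseSpace d => f z.snd) z‖ ≤ ‖iteratedFDeriv ℝ i f z.snd‖ := by
  let L : PhaseSpace d →L[ℝ] Space d := WithLp.sndL 2 ℝ (Space d) (Space d)
  have hL : ‖L‖ ≤ 1 := L.opNorm_le_bound zero_le_one fun z => by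
    simpa [L] using WithLp.norm_snd_le _ z
  have h := L.iteratedFDeriv_comp_right (f.smooth ⊤) z (i := i) (mod_cast le_top)
  have h' : (f ∘ L) = fun z : PhaseSpace d => f z.snd := rfl
  rw [← h', h]
  refine (ContinuousMultilinearMap.norm_compContinuousLinearMap_le _ _).trans ?_
  refine mul_le_of_le_one_right (norm_nonneg _) ?_
  exact Finset.prod_le_one (fun _ _ => norm_nonneg _) fun _ _ => hL

theorem contDiff_comp_fst (f : 𝓢(Space d, ℂ)) :
    ContDiff ℝ (⊤ : ℕ∞) (fun z : PhaseSpace d => f z.fst) :=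
  (f.smooth ⊤).comp (WithLp.fstL 2 ℝ (Space d) (Space d)).contDiff

theorem contDiff_comp_snd (f : 𝓢(Space d, ℂ)) :
    ContDiff ℝ (⊤ : ℕ∞) (fun z : PhaseSpace d => f z.snd) :=
  (f.smooth ⊤).comp (WithLp.sndL 2 ℝ (Space d) (Space d)).contDiff

theorem tensor_bound (k n : ℕ) (f g : 𝓢(Space d, ℂ)) (z : PhaseSpace d) :
    ‖z‖ ^ k * ‖iteratedFDeriv ℝ n (fun z : PhaseSpace d => f z.fst * g z.snd) z‖ ≤
      2 ^ n * 2 ^ k * 2 ^ k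
        * (Finset.Iic (k, n)).sup (schwartzSeminormFamily ℂ (Space d) ℂ) f
        * (Finset.Iic (k, n)).sup (schwartzSeminormFamily ℂ (Space d) ℂ) g := by
  set A := (Finset.Iic (k, n)).sup (schwartzSeminormFamily ℂ (Space d) ℂ) f
  set B := (Finset.Iic (k, n)).sup (schwartzSeminormFamily ℂ (Space d) ℂ) g
  have hz : ‖z‖ ≤ (1 + ‖z.fst‖) * (1 + ‖z.snd‖) := by
    have h1 : ‖z‖ ≤ ‖z.fst‖ + ‖z.snd‖ := by
      rw [WithLp.prod_norm_eq_of_L2]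
      refine Real.sqrt_le_iff.2 ⟨by positivity, ?_⟩
      nlinarith [norm_nonneg z.fst, norm_nonneg z.snd]
    nlinarith [norm_nonneg z.fst, norm_nonneg z.snd]
  have hzk : ‖z‖ ^ k ≤ (1 + ‖z.fst‖) ^ k * (1 + ‖z.snd‖) ^ k := by
    rw [← mul_pow]
    exact pow_le_pow_left₀ (norm_nonneg _) hz k
  have hA : ∀ i ≤ n, (1 + ‖z.fst‖) ^ k * ‖iteratedFDeriv ℝ i f z.fst‖ ≤ 2 ^ k * A :=
    fun i hi => SchwartzMap.one_add_le_sup_seminorm_apply (𝕜 := ℂ) (m := (k, n)) le_rfl hi f z.fst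
  have hB : ∀ i ≤ n, (1 + ‖z.snd‖) ^ k * ‖iteratedFDeriv ℝ i g z.snd‖ ≤ 2 ^ k * B :=
    fun i hi => SchwartzMap.one_add_le_sup_seminorm_apply (𝕜 := ℂ) (m := (k, n)) le_rfl hi g z.snd
  have hA0 : 0 ≤ 2 ^ k * A := le_trans (by positivity) (hA 0 (Nat.zero_le _))
  have hmul := norm_iteratedFDeriv_mul_le (contDiff_comp_fst f) (contDiff_comp_snd g) z
    (n := n) (mod_cast le_top)
  calc ‖z‖ ^ k * ‖iteratedFDeriv ℝ n (fun z : PhaseSpace d => f z.fst * g z.snd) z‖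
      ≤ ((1 + ‖z.fst‖) ^ k * (1 + ‖z.snd‖) ^ k) *
        ∑ i ∈ Finset.range (n + 1), (n.choose i : ℝ)
          * ‖iteratedFDeriv ℝ i (fun z : PhaseSpace d => f z.fst) z‖
          * ‖iteratedFDeriv ℝ (n - i) (fun z : PhaseSpace d => g z.snd) z‖ := by
        gcongr
    _ ≤ ((1 + ‖z.fst‖) ^ k * (1 + ‖z.snd‖) ^ k) *
        ∑ i ∈ Finset.range (n + 1), (n.choose i : ℝ)
          * ‖iteratedFDeriv ℝ i f z.fst‖ * ‖iteratedFDeriv ℝ (n - i) g z.snd‖ := by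
        gcongr with i _
        · exact norm_iteratedFDeriv_comp_fst_le f i z
        · exact norm_iteratedFDeriv_comp_snd_le g (n - i) z
    _ = ∑ i ∈ Finset.range (n + 1), (n.choose i : ℝ)
          * (((1 + ‖z.fst‖) ^ k * ‖iteratedFDeriv ℝ i f z.fst‖)
            * ((1 + ‖z.snd‖) ^ k * ‖iteratedFDeriv ℝ (n - i) g z.snd‖)) := by
        rw [Finset.mul_sum]
        exact Finset.sum_congr rfl fun i _ => by ring
    _ ≤ ∑ i ∈ Finset.range (n + 1), (n.choose i : ℝ) * ((2 ^ k * A) * (2 ^ k * B)) := by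
        refine Finset.sum_le_sum fun i hi => mul_le_mul_of_nonneg_left ?_ (by positivity)
        exact mul_le_mul (hA i (by grind)) (hB (n - i) (by omega)) (by positivity) hA0
    _ = 2 ^ n * 2 ^ k * 2 ^ k * A * B := by
        rw [← Finset.sum_mul, ← Nat.cast_sum, Nat.sum_range_choose]
        push_cast
        ring

/-- The map `f ↦ f ⊗ g`, where `(f ⊗ g)(x, ω) = f(x) g(ω)`. -/
def tensorRight (g : 𝓢(Space d, ℂ)) : 𝓢(Space d, ℂ) →L[ℂ] 𝓢(PhaseSpace d, ℂ) :=
  SchwartzMap.mkCLM (fun f z => f z.fst * g z.snd)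
    (fun f₁ f₂ z => by simp [add_mul]) (fun c f z => by simp [mul_assoc])
    (fun f => (contDiff_comp_fst f).mul (contDiff_comp_snd g)) fun m =>
      ⟨Finset.Iic m, 2 ^ m.2 * 2 ^ m.1 * 2 ^ m.1
        * (Finset.Iic m).sup (schwartzSeminormFamily ℂ (Space d) ℂ) g,
        mul_nonneg (by positivity) (apply_nonneg _ _), fun f z =>
          (tensor_bound m.1 m.2 f g z).trans_eq (by ring)⟩

/-- The map `g ↦ f ⊗ g`, where `(f ⊗ g)(x, ω) = f(x) g(ω)`. -/
def tensorLeft (f : 𝓢(Space d, ℂ)) : 𝓢(Space d, ℂ) →L[ℂ] 𝓢(PhaseSpace d, ℂ) :=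
  SchwartzMap.mkCLM (fun g z => f z.fst * g z.snd)
    (fun g₁ g₂ z => by simp [mul_add]) (fun c g z => by simp [mul_left_comm])
    (fun g => (contDiff_comp_fst f).mul (contDiff_comp_snd g)) fun m =>
      ⟨Finset.Iic m, 2 ^ m.2 * 2 ^ m.1 * 2 ^ m.1
        * (Finset.Iic m).sup (schwartzSeminormFamily ℂ (Space d) ℂ) f,
        mul_nonneg (by positivity) (apply_nonneg _ _), fun g z =>
          tensor_bound m.1 m.2 f g z⟩

/-- The function `(x, ω) ↦ e^{2πi s x·ω}` on phase space. -/
def chirp (s : ℝ) (z : PhaseSpace d) : ℂ := expi (s * ⟪z.fst, z.snd⟫_ℝ)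

theorem chirp_hasTemperateGrowth (s : ℝ) :
    Function.HasTemperateGrowth (chirp s : PhaseSpace d → ℂ) := by
  refine expi_hasTemperateGrowth.comp
    (f := fun z : PhaseSpace d => s * ⟪z.fst, z.snd⟫_ℝ) ?_
  refine (Function.HasTemperateGrowth.const s).mul ?_
  exact (innerSL ℝ (E := Space d)).bilinear_hasTemperateGrowth (𝕜 := ℝ)
    (WithLp.fstL 2 ℝ (Space d) (Space d)).hasTemperateGrowth
    (WithLp.sndL 2 ℝ (Space d) (Space d)).hasTemperateGrowth

/-- The Rihaczek distribution `W_0(f, g)`, as a Schwartz function on phase space: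
`W_0(f, g)(x, ω) = e^{-2πi x·ω} f(x) conj (ĝ(ω))`. -/
def rihaczek (f g : 𝓢(Space d, ℂ)) : 𝓢(PhaseSpace d, ℂ) :=
  SchwartzMap.smulLeftCLM ℂ (chirp (-1)) (tensorRight (conjS (𝓕 g)) f)

/-- The conjugate Rihaczek distribution `W_1(f, g)`, as a Schwartz function on phase space:
`W_1(f, g)(x, ω) = e^{2πi x·ω} conj (g(x)) f̂(ω)`. -/
def conjRihaczek (f g : 𝓢(Space d, ℂ)) : 𝓢(PhaseSpace d, ℂ) :=
  SchwartzMap.smulLeftCLM ℂ (chirp 1) (tensorLeft (conjS g) (𝓕 f))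

theorem rihaczek_apply (f g : 𝓢(Space d, ℂ)) (z : PhaseSpace d) :
    rihaczek f g z = chirp (-1) z * (f z.fst * conj (𝓕 g z.snd)) := by
  rw [rihaczek, SchwartzMap.smulLeftCLM_apply_apply (chirp_hasTemperateGrowth _), smul_eq_mul]
  rfl

theorem conjRihaczek_apply (f g : 𝓢(Space d, ℂ)) (z : PhaseSpace d) :
    conjRihaczek f g z = chirp 1 z * (conj (g z.fst) * 𝓕 f z.snd) := by
  rw [conjRihaczek, SchwartzMap.smulLeftCLM_apply_apply (chirp_hasTemperateGrowth _), smul_eq_mul]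
  rfl

theorem fourier_apply_eq (f : 𝓢(Space d, ℂ)) (ω : Space d) :
    𝓕 f ω = ∫ y : Space d, expi (-⟪y, ω⟫_ℝ) * f y := by
  rw [SchwartzMap.fourier_coe, Real.fourier_eq']
  refine integral_congr_ae (Filter.Eventually.of_forall fun y => ?_)
  simp only [expi, smul_eq_mul]
  congr 3
  push_cast
  ring

theorem expi_add (s t : ℝ) : expi (s + t) = expi s * expi t := by
  simp only [expi, ← Complex.exp_add]
  congr 1
  push_cast
  ring

theorem conj_expi (s : ℝ) : conj (expi s) = expi (-s) := by
  simp only [expi, ← Complex.exp_conj]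
  congr 1
  rw [map_mul, Complex.conj_ofReal, Complex.conj_I]
  push_cast
  ring

/-- The Rihaczek distribution is the `τ`-Wigner distribution with `τ = 0`. -/
theorem rihaczek_eq_tauWigner (f g : 𝓢(Space d, ℂ)) (z : PhaseSpace d) :
    rihaczek f g z = tauWigner 0 f g z := by
  rw [rihaczek_apply, fourier_apply_eq, ← integral_conj, tauWigner,
    ← integral_sub_left_eq_self (μ := volume) _ z.fst, ← integral_const_mul,
    ← integral_const_mul]
  refine integral_congr_ae (Filter.Eventually.of_forall fun y => ?_)
  simp only [chirp, map_mul, conj_expi, zero_smul, add_zero, sub_zero, one_smul]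
  have h : expi (-⟪y, z.snd⟫_ℝ) =
      expi (-1 * ⟪z.fst, z.snd⟫_ℝ) * expi (- -⟪z.fst - y, z.snd⟫_ℝ) := by
    rw [← expi_add, inner_sub_left]
    congr 1
    ring
  rw [h]
  ring

/-- The conjugate Rihaczek distribution is the `τ`-Wigner distribution with `τ = 1`. -/
theorem conjRihaczek_eq_tauWigner (f g : 𝓢(Space d, ℂ)) (z : PhaseSpace d) :
    conjRihaczek f g z = tauWigner 1 f g z := by
  rw [conjRihaczek_apply, fourier_apply_eq, tauWigner,
    ← integral_add_left_eq_self (μ := volume) _ z.fst, ← integral_const_mul,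
    ← integral_const_mul]
  refine integral_congr_ae (Filter.Eventually.of_forall fun y => ?_)
  simp only [chirp, sub_self, zero_smul, sub_zero, one_smul]
  have h : expi (-⟪y, z.snd⟫_ℝ) =
      expi (1 * ⟪z.fst, z.snd⟫_ℝ) * expi (-⟪z.fst + y, z.snd⟫_ℝ) := by
    rw [← expi_add, inner_add_left]
    congr 1
    ring
  rw [h]
  ring

/-- The Kohn-Nirenberg operator `Op_0(σ) f`, as the tempered distribution
`h ↦ σ(e^{2πi x·ω} h(x) f̂(ω))`. -/
def opKN (σ : 𝓢'(PhaseSpace d, ℂ)) (f : 𝓢(Space d, ℂ)) : 𝓢'(Space d, ℂ) :=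
  PointwiseConvergenceCLM.precomp ℂ
    (SchwartzMap.smulLeftCLM ℂ (chirp 1) ∘L tensorRight (𝓕 f)) σ

/-- The anti-Kohn-Nirenberg operator `Op_1(σ) f`, as the tempered distribution
`h ↦ σ(e^{-2πi x·ω} f(x) (𝓕⁻¹ h)(ω))`. -/
def opAntiKN (σ : 𝓢'(PhaseSpace d, ℂ)) (f : 𝓢(Space d, ℂ)) : 𝓢'(Space d, ℂ) :=
  PointwiseConvergenceCLM.precomp ℂ
    (SchwartzMap.smulLeftCLM ℂ (chirp (-1)) ∘L tensorLeft f
      ∘L fourierInvCLM ℂ 𝓢(Space d, ℂ)) σ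

/-- The weak definition `⟨Op_0(σ) f, g⟩ = ⟨σ, W_0(g, f)⟩`. -/
theorem bracket_opKN (σ : 𝓢'(PhaseSpace d, ℂ)) (f g : 𝓢(Space d, ℂ)) :
    bracket (opKN σ f) g = bracket σ (rihaczek g f) := by
  have h : SchwartzMap.smulLeftCLM ℂ (chirp 1) (tensorRight (𝓕 f) (conjS g))
      = conjS (rihaczek g f) := by
    ext z
    rw [SchwartzMap.smulLeftCLM_apply_apply (chirp_hasTemperateGrowth _), conjS_apply,
      rihaczek_apply]
    simp only [chirp, map_mul, conj_expi, Complex.conj_conj, smul_eq_mul, neg_mul, neg_neg]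
    rfl
  change σ _ = σ _
  rw [← h]
  rfl

/-- The weak definition `⟨Op_1(σ) f, g⟩ = ⟨σ, W_1(g, f)⟩`. -/
theorem bracket_opAntiKN (σ : 𝓢'(PhaseSpace d, ℂ)) (f g : 𝓢(Space d, ℂ)) :
    bracket (opAntiKN σ f) g = bracket σ (conjRihaczek g f) := by
  have hF : ∀ ω, 𝓕⁻ (conjS g) ω = conj (𝓕 g ω) := by
    intro ω
    rw [fourier_apply_eq, ← integral_conj, SchwartzMap.fourierInv_coe, Real.fourierInv_eq']
    refine integral_congr_ae (Filter.Eventually.of_forall fun y => ?_)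
    simp only [map_mul, conj_expi, neg_neg, conjS_apply, smul_eq_mul]
    rfl
  have h : SchwartzMap.smulLeftCLM ℂ (chirp (-1)) (tensorLeft f (𝓕⁻ (conjS g)))
      = conjS (conjRihaczek g f) := by
    ext z
    rw [SchwartzMap.smulLeftCLM_apply_apply (chirp_hasTemperateGrowth _), conjS_apply,
      conjRihaczek_apply]
    simp only [chirp, map_mul, conj_expi, Complex.conj_conj, smul_eq_mul, neg_mul, ← hF]
    rfl
  change σ _ = σ _
  rw [← h]
  rfl

end TimeFrequency

end

/-! Everything rests on the time-frequency kernel of the operator. Pairing `Op_0(σ) π(z)g` with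
`π(w)h` tests `σ` on the Rihaczek distribution of two shifted functions. By `rihaczek_tfShift` this
is, up to a unimodular factor, a shift of the fixed Schwartz function `rihaczek h g`, placed at the
phase space point `(w.1, z.2)`. The kernel is therefore a short-time Fourier transform of `σ` at
that point, and taking the supremum over its frequency leaves a bound `H(w.1, z.2)`, where `H` is
integrable because `σ ∈ W(𝓕L^∞, L^1)`. For `Op_1(σ)` the point is `(z.1, w.2)`: time and frequency
change roles. The isometry `e` (identity or swap) lets one argument serve both cases; `mixedNorm e`
is then the norm of `M^{1,∞}` or of `W(𝓕L^1, L^∞)`.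

Given such a bound, boundedness is a Schur-type estimate. Since `H(p.1, q.2)` ignores `q.1`,
integrating `|V_g f|` over `q.1` first costs the norm of `f` (`lintegral_mul_snd_le`). What remains
is `∫ H(p.1, b) db`, which ignores `p.2` and has integral `‖H‖₁` in `p.1`
(`HasDominatedKernel.isBoundedOperator`).

The extension must also be a tempered distribution, independent of the window. For its existence the
weak integral against each fixed `h` has to converge, which needs the slice integral `∫ H(0, b) db`
to be finite. Integrability of `H` alone does not give this, so `H` is taken to be the supremum
transform of `σ` convolved with a polynomially decaying weight (`envelope`). Window independence is
Fubini combined with the inversion formula for Schwartz functions and the reproducing formula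
(`energy_mul_integral_eq`). Both formulas require tempered distributions to commute with integrals
of Schwartz functions, which is `integral_comp_schwartz`. -/

noncomputable section

namespace TimeFrequency

/-! ### Weak integrals in the Schwartz space -/

section WeakIntegral

variable {V : Type*} [NormedAddCommGroup V] [NormedSpace ℝ V]

/-- The weighted derivative `x ↦ ‖x‖ᵏ Dⁿψ(x)` as a bounded continuous function. -/
def weightedDeriv (k n : ℕ) (ψ : 𝓢(V, ℂ)) :
    BoundedContinuousFunction V (ContinuousMultilinearMap ℝ (fun _ : Fin n => V) ℂ) :=
  BoundedContinuousFunction.ofNormedAddCommGroup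
    (fun x => ‖x‖ ^ k • iteratedFDeriv ℝ n ψ x)
    ((continuous_norm.pow k).smul ((ψ.smooth ⊤).continuous_iteratedFDeriv (mod_cast le_top)))
    (SchwartzMap.seminorm ℝ k n ψ) fun x => by
      rw [norm_smul, norm_pow, norm_norm]
      exact SchwartzMap.le_seminorm ℝ k n ψ x

theorem weightedDeriv_apply (k n : ℕ) (ψ : 𝓢(V, ℂ)) (x : V) :
    weightedDeriv k n ψ x = ‖x‖ ^ k • iteratedFDeriv ℝ n ψ x := rfl

theorem norm_weightedDeriv_le (k n : ℕ) (ψ : 𝓢(V, ℂ)) :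
    ‖weightedDeriv k n ψ‖ ≤ SchwartzMap.seminorm ℝ k n ψ :=
  BoundedContinuousFunction.norm_ofNormedAddCommGroup_le _ (apply_nonneg _ _) _

theorem seminorm_le_norm_weightedDeriv (k n : ℕ) (ψ : 𝓢(V, ℂ)) :
    SchwartzMap.seminorm ℝ k n ψ ≤ ‖weightedDeriv k n ψ‖ := by
  refine SchwartzMap.seminorm_le_bound ℝ k n ψ (norm_nonneg (weightedDeriv k n ψ)) fun x => ?_
  have h := (weightedDeriv k n ψ).norm_coe_le_norm x
  rwa [weightedDeriv_apply, norm_smul, norm_pow, norm_norm] at h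

theorem weightedDeriv_add (k n : ℕ) (f g : 𝓢(V, ℂ)) :
    weightedDeriv k n (f + g) = weightedDeriv k n f + weightedDeriv k n g := by
  refine BoundedContinuousFunction.ext fun x => ?_
  have h : iteratedFDeriv ℝ n (⇑(f + g)) x = iteratedFDeriv ℝ n f x + iteratedFDeriv ℝ n g x :=
    iteratedFDeriv_add_apply ((f.smooth n).contDiffAt) ((g.smooth n).contDiffAt)
  simp only [weightedDeriv_apply, BoundedContinuousFunction.coe_add, Pi.add_apply, h, smul_add]

theorem weightedDeriv_smul (k n : ℕ) (c : ℝ) (f : 𝓢(V, ℂ)) :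
    weightedDeriv k n (c • f) = c • weightedDeriv k n f := by
  refine BoundedContinuousFunction.ext fun x => ?_
  have h : iteratedFDeriv ℝ n (⇑(c • f)) x = c • iteratedFDeriv ℝ n f x :=
    iteratedFDeriv_const_smul_apply ((f.smooth n).contDiffAt)
  simp only [weightedDeriv_apply, BoundedContinuousFunction.coe_smul, h]
  rw [smul_comm]

/-- The map `ψ ↦ (x ↦ ‖x‖ᵏ Dⁿψ(x))` as a continuous linear map. -/
def weightedDerivCLM (k n : ℕ) :
    𝓢(V, ℂ) →L[ℝ] BoundedContinuousFunction V (ContinuousMultilinearMap ℝ (fun _ : Fin n => V) ℂ) :=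
  SchwartzMap.mkCLMtoNormedSpace (𝕜 := ℝ) (𝕜' := ℝ) (σ := RingHom.id ℝ) (fun ψ : 𝓢(V, ℂ) => weightedDeriv k n ψ)
    (weightedDeriv_add k n) (weightedDeriv_smul k n)
    ⟨{(k, n)}, 1, zero_le_one, fun f => by
      rw [one_mul, Finset.sup_singleton]
      exact norm_weightedDeriv_le k n f⟩

theorem weightedDerivCLM_apply (k n : ℕ) (ψ : 𝓢(V, ℂ)) (x : V) :
    weightedDerivCLM k n ψ x = ‖x‖ ^ k • iteratedFDeriv ℝ n ψ x := rfl

theorem continuous_iteratedFDeriv_apply (n : ℕ) (x : V) :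
    Continuous fun ψ : 𝓢(V, ℂ) => iteratedFDeriv ℝ n ψ x := by
  have h : (fun ψ : 𝓢(V, ℂ) => iteratedFDeriv ℝ n ψ x) = fun ψ => weightedDerivCLM 0 n ψ x := by
    funext ψ
    rw [weightedDerivCLM_apply, pow_zero, one_smul]
  rw [h]
  exact (BoundedContinuousFunction.evalCLM ℝ x).continuous.comp
    (weightedDerivCLM (V := V) 0 n).continuous

variable {Z : Type*} [TopologicalSpace Z] [SecondCountableTopology Z] [MeasurableSpace Z]
  [OpensMeasurableSpace Z] {μ : Measure Z}

theorem integrable_iteratedFDeriv_apply {Ψ : Z → 𝓢(V, ℂ)} (hΨ : Continuous Ψ)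
    (hint : ∀ k n : ℕ, Integrable (fun z => SchwartzMap.seminorm ℝ k n (Ψ z)) μ) (n : ℕ) (x : V) :
    Integrable (fun z => iteratedFDeriv ℝ n (Ψ z) x) μ :=
  (hint 0 n).mono' ((continuous_iteratedFDeriv_apply n x).comp hΨ).aestronglyMeasurable
    (Filter.Eventually.of_forall fun z => SchwartzMap.norm_iteratedFDeriv_le_seminorm ℝ (Ψ z) n x)

/-- A pointwise integral of Schwartz functions can be differentiated under the integral sign. -/
theorem iteratedFDeriv_eq_integral {Ψ : Z → 𝓢(V, ℂ)} (hΨ : Continuous Ψ)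
    (hint : ∀ k n : ℕ, Integrable (fun z => SchwartzMap.seminorm ℝ k n (Ψ z)) μ)
    {ψ : 𝓢(V, ℂ)} (hψ : ∀ x, ψ x = ∫ z, Ψ z x ∂μ) (n : ℕ) :
    ∀ x, iteratedFDeriv ℝ n ψ x = ∫ z, iteratedFDeriv ℝ n (Ψ z) x ∂μ := by
  induction n with
  | zero =>
    intro x
    simp only [iteratedFDeriv_zero_eq_comp, Function.comp_apply, hψ x]
    exact ((continuousMultilinearCurryFin0 ℝ V ℂ).symm.toContinuousLinearEquiv.integral_comp_comm
      (fun z => Ψ z x)).symm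
  | succ n ih =>
    intro x
    let e := continuousMultilinearCurryLeftEquiv ℝ (fun _ : Fin (n + 1) => V) ℂ
    have hd : ∀ (φ : 𝓢(V, ℂ)) (y : V), HasFDerivAt (iteratedFDeriv ℝ n φ)
        (e (iteratedFDeriv ℝ (n + 1) φ y)) y := fun φ y => by
      have h := ((φ.smooth ⊤).differentiable_iteratedFDeriv (m := n)
        (mod_cast ENat.natCast_lt_top n) y).hasFDerivAt
      have h2 : fderiv ℝ (iteratedFDeriv ℝ n φ) y = e (iteratedFDeriv ℝ (n + 1) φ y) :=
        congrFun (fderiv_iteratedFDeriv (𝕜 := ℝ) (f := φ) (n := n)) y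
      rwa [← h2]
    -- The unweighted seminorm of order `n + 1` bounds the next derivative uniformly in the space
    -- variable, so it dominates on all of `V`.
    have h1 := hasFDerivAt_integral_of_dominated_of_fderiv_le (𝕜 := ℝ) (μ := μ)
      (F := fun y z => iteratedFDeriv ℝ n (Ψ z) y)
      (F' := fun y z => e (iteratedFDeriv ℝ (n + 1) (Ψ z) y))
      (bound := fun z => SchwartzMap.seminorm ℝ 0 (n + 1) (Ψ z)) (x₀ := x) (s := Set.univ)
      Filter.univ_mem
      (Filter.Eventually.of_forall fun y =>
        (integrable_iteratedFDeriv_apply hΨ hint n y).aestronglyMeasurable)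
      (integrable_iteratedFDeriv_apply hΨ hint n x)
      (e.continuous.comp_aestronglyMeasurable
        (integrable_iteratedFDeriv_apply hΨ hint (n + 1) x).aestronglyMeasurable)
      (Filter.Eventually.of_forall fun z y _ => by
        rw [e.norm_map]
        exact SchwartzMap.norm_iteratedFDeriv_le_seminorm ℝ (Ψ z) (n + 1) y)
      (hint 0 (n + 1))
      (Filter.Eventually.of_forall fun z y _ => hd (Ψ z) y)
    have h2 : (fun y => ∫ z, iteratedFDeriv ℝ n (Ψ z) y ∂μ) = iteratedFDeriv ℝ n ψ :=
      funext fun y => (ih y).symm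
    rw [h2] at h1
    have h3 := (hd ψ x).unique h1
    let e' : (ContinuousMultilinearMap ℝ (fun _ : Fin (n + 1) => V) ℂ) →L[ℝ]
        V →L[ℝ] (ContinuousMultilinearMap ℝ (fun _ : Fin n => V) ℂ) :=
      e.toContinuousLinearEquiv.toContinuousLinearMap
    have h4 := ContinuousLinearMap.integral_comp_comm (𝕜 := ℝ)
      (Fₗ := V →L[ℝ] (ContinuousMultilinearMap ℝ (fun _ : Fin n => V) ℂ)) e'
      (integrable_iteratedFDeriv_apply hΨ hint (n + 1) x)
    exact e.injective (h3.trans h4)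

/-- A functional dominated by the norm of an injective linear map factors through it. -/
theorem exists_continuousLinearMap_comp_eq {S E : Type*} [AddCommGroup S] [Module ℝ S]
    [NormedAddCommGroup E] [NormedSpace ℝ E] (J : S →ₗ[ℝ] E) (hJ : Function.Injective J)
    (L : S →ₗ[ℝ] ℂ) (C : ℝ) (h : ∀ φ, ‖L φ‖ ≤ C * ‖J φ‖) :
    ∃ K : E →L[ℝ] ℂ, ∀ φ, K (J φ) = L φ := by
  let ι := LinearEquiv.ofInjective J hJ
  let M : LinearMap.range J →L[ℝ] ℂ :=
    LinearMap.mkContinuous (L ∘ₗ ι.symm.toLinearMap) C fun y => by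
      obtain ⟨φ, rfl⟩ := ι.surjective y
      change ‖L (ι.symm (ι φ))‖ ≤ C * ‖J φ‖
      rw [ι.symm_apply_apply]
      exact h φ
  -- Hahn–Banach, with values in the finite-dimensional real space `ℂ`.
  obtain ⟨K, hK⟩ := M.exist_extension_of_finiteDimensional_range
  refine ⟨K, fun φ => ?_⟩
  have h1 := congrArg (fun u => u (ι φ)) hK
  have h2 : M (ι φ) = L φ := by simp [M]
  rw [← h2]
  exact h1.symm

/-- Finite families of bounded continuous fields of multilinear maps. -/
abbrev JetSpace (V : Type*) [NormedAddCommGroup V] [NormedSpace ℝ V] (t : Finset (ℕ × ℕ)) : Type _ :=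
  (i : t) → BoundedContinuousFunction V (ContinuousMultilinearMap ℝ (fun _ : Fin i.1.2 => V) ℂ)

instance (t : Finset (ℕ × ℕ)) : NormedAddCommGroup (JetSpace V t) := Pi.normedAddCommGroup

instance (t : Finset (ℕ × ℕ)) : NormedSpace ℝ (JetSpace V t) := Pi.normedSpace

/-- A continuous functional on the Schwartz space commutes with absolutely convergent
integrals of Schwartz functions. -/
theorem integral_comp_schwartz {Ψ : Z → 𝓢(V, ℂ)} (hΨ : Continuous Ψ)
    (hint : ∀ k n : ℕ, Integrable (fun z => SchwartzMap.seminorm ℝ k n (Ψ z)) μ)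
    {ψ : 𝓢(V, ℂ)} (hψ : ∀ x, ψ x = ∫ z, Ψ z x ∂μ) (L : 𝓢(V, ℂ) →L[ℝ] ℂ) :
    Integrable (fun z => L (Ψ z)) μ ∧ L ψ = ∫ z, L (Ψ z) ∂μ := by
  obtain ⟨s, C, -, hL⟩ := Seminorm.bound_of_continuous (schwartz_withSeminorms ℝ V ℂ)
    ((normSeminorm ℝ ℂ).comp (L : 𝓢(V, ℂ) →ₗ[ℝ] ℂ)) (continuous_norm.comp L.continuous)
  -- Finitely many seminorms control `L`, so `L` factors through a Banach space of jets, where the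
  -- Bochner integral is available. The index `(0, 0)` is added to make the jet map injective.
  let t : Finset (ℕ × ℕ) := insert (0, 0) s
  let J : 𝓢(V, ℂ) →L[ℝ] JetSpace V t :=
    ContinuousLinearMap.pi fun i : t => weightedDerivCLM i.1.1 i.1.2
  have hJapply : ∀ φ i x, J φ i x = ‖x‖ ^ i.1.1 • iteratedFDeriv ℝ i.1.2 φ x := fun _ _ _ => rfl
  have hbound : ∀ φ, ‖L φ‖ ≤ C * ‖J φ‖ := by
    intro φ
    have h1 := hL φ
    refine h1.trans ?_
    change (C : ℝ) * _ ≤ _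
    gcongr
    refine Seminorm.finset_sup_apply_le (norm_nonneg _) fun i hi => ?_
    exact (seminorm_le_norm_weightedDeriv i.1 i.2 φ).trans
      (norm_le_pi_norm (J φ) ⟨i, Finset.mem_insert_of_mem hi⟩)
  let J' : 𝓢(V, ℂ) →ₗ[ℝ] JetSpace V t := J.toLinearMap
  have hinj : Function.Injective J' := by
    intro φ₁ φ₂ h
    ext x
    have h2 := congrArg (fun u : JetSpace V t => u ⟨(0, 0), Finset.mem_insert_self _ _⟩ x ![]) h
    change (J φ₁ ⟨(0, 0), _⟩ x) ![] = (J φ₂ ⟨(0, 0), _⟩ x) ![] at h2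
    simpa [hJapply] using h2
  obtain ⟨K, hK⟩ := exists_continuousLinearMap_comp_eq J' hinj (L : 𝓢(V, ℂ) →ₗ[ℝ] ℂ) C hbound
  have hKJ : ∀ φ, K (J φ) = L φ := hK
  -- Spaces of bounded continuous functions need not be separable; strong measurability comes from
  -- second countability of `Z`.
  have hsc : SecondCountableTopologyEither Z (JetSpace V t) := ⟨Or.inl inferInstance⟩
  have hJint : Integrable (fun z => J (Ψ z)) μ := by
    refine Integrable.mono' (g := fun z => ∑ i : t, SchwartzMap.seminorm ℝ i.1.1 i.1.2 (Ψ z))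
      (integrable_finsetSum _ fun i _ => hint _ _)
      (J.continuous.comp hΨ).aestronglyMeasurable (Filter.Eventually.of_forall fun z => ?_)
    refine (pi_norm_le_iff_of_nonneg (Finset.sum_nonneg fun i _ => apply_nonneg _ _)).2 fun i => ?_
    refine (norm_weightedDeriv_le i.1.1 i.1.2 (Ψ z)).trans ?_
    exact Finset.single_le_sum (f := fun i : t => SchwartzMap.seminorm ℝ i.1.1 i.1.2 (Ψ z))
      (fun i _ => apply_nonneg _ _) (Finset.mem_univ i)
  have hJψ : J ψ = ∫ z, J (Ψ z) ∂μ := by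
    funext i
    ext1 x
    have h := ((BoundedContinuousFunction.evalCLM ℝ x).comp
      (ContinuousLinearMap.proj (R := ℝ) (φ := fun i : t => BoundedContinuousFunction V
        (ContinuousMultilinearMap ℝ (fun _ : Fin i.1.2 => V) ℂ)) i)).integral_comp_comm hJint
    refine Eq.trans ?_ h
    change ‖x‖ ^ i.1.1 • iteratedFDeriv ℝ i.1.2 ψ x
      = ∫ z, ‖x‖ ^ i.1.1 • iteratedFDeriv ℝ i.1.2 (Ψ z) x ∂μ
    rw [integral_smul, iteratedFDeriv_eq_integral hΨ hint hψ]
  have h := K.integral_comp_comm hJint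
  simp only [hKJ] at h
  refine ⟨?_, ?_⟩
  · have h2 := K.integrable_comp hJint
    simpa only [hKJ] using h2
  · rw [h, ← hJψ, hKJ]

end WeakIntegral

/-! ### Translations of Schwartz functions -/

section Translation

variable {V : Type*} [NormedAddCommGroup V] [NormedSpace ℝ V]

/-- A seminorm dominating the first `n` derivatives of `ψ`, weighted by `(1 + ‖x‖)ᵏ`. -/
def weightedSup (k n : ℕ) (ψ : 𝓢(V, ℂ)) : ℝ :=
  2 ^ k * (Finset.Iic (k, n)).sup (schwartzSeminormFamily ℝ V ℂ) ψ

theorem weightedSup_nonneg (k n : ℕ) (ψ : 𝓢(V, ℂ)) : 0 ≤ weightedSup k n ψ :=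
  mul_nonneg (by positivity) (apply_nonneg _ _)

theorem weightedSup_zero (k n : ℕ) : weightedSup k n (0 : 𝓢(V, ℂ)) = 0 := by
  simp [weightedSup]

theorem continuous_weightedSup (k n : ℕ) : Continuous (weightedSup k n : 𝓢(V, ℂ) → ℝ) := by
  refine continuous_const.mul ?_
  induction Finset.Iic (k, n) using Finset.induction_on with
  | empty => exact continuous_const
  | insert i s hi ih =>
    rw [Finset.sup_insert, Seminorm.coe_sup]
    exact ((schwartz_withSeminorms ℝ V ℂ).continuous_seminorm i).sup ih

theorem one_add_pow_mul_le_weightedSup {k n m : ℕ} (hm : m ≤ n) (ψ : 𝓢(V, ℂ)) (x : V) :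
    (1 + ‖x‖) ^ k * ‖iteratedFDeriv ℝ m ψ x‖ ≤ weightedSup k n ψ :=
  SchwartzMap.one_add_le_sup_seminorm_apply (𝕜 := ℝ) (m := (k, n)) le_rfl hm ψ x

theorem one_add_pow_mul_norm_le_weightedSup (k : ℕ) (ψ : 𝓢(V, ℂ)) (x : V) :
    (1 + ‖x‖) ^ k * ‖ψ x‖ ≤ weightedSup k 0 ψ := by
  simpa using one_add_pow_mul_le_weightedSup (k := k) le_rfl ψ x (n := 0)

theorem one_add_norm_le_mul {V : Type*} [SeminormedAddCommGroup V] (t x : V) : 1 + ‖t‖ ≤ (1 + ‖x‖) * (1 + ‖t - x‖) := by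
  have h : ‖t‖ ≤ ‖x‖ + ‖t - x‖ := by simpa using norm_add_le x (t - x)
  nlinarith [norm_nonneg x, norm_nonneg (t - x)]

theorem seminorm_compSubConst_le (k n : ℕ) (x : V) (g : 𝓢(V, ℂ)) :
    SchwartzMap.seminorm ℝ k n (SchwartzMap.compSubConstCLM ℂ x g)
      ≤ (1 + ‖x‖) ^ k * weightedSup k n g := by
  refine SchwartzMap.seminorm_le_bound ℝ k n _
    (mul_nonneg (by positivity) (weightedSup_nonneg _ _ _)) fun t => ?_
  have h1 : iteratedFDeriv ℝ n (SchwartzMap.compSubConstCLM ℂ x g) t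
      = iteratedFDeriv ℝ n g (t - x) := iteratedFDeriv_comp_sub n x t
  rw [h1]
  have h2 : ‖t‖ ^ k ≤ (1 + ‖x‖) ^ k * (1 + ‖t - x‖) ^ k := by
    rw [← mul_pow]
    exact pow_le_pow_left₀ (norm_nonneg _) (by linarith [one_add_norm_le_mul t x]) k
  calc ‖t‖ ^ k * ‖iteratedFDeriv ℝ n g (t - x)‖
      ≤ ((1 + ‖x‖) ^ k * (1 + ‖t - x‖) ^ k) * ‖iteratedFDeriv ℝ n g (t - x)‖ := by gcongr
    _ = (1 + ‖x‖) ^ k * ((1 + ‖t - x‖) ^ k * ‖iteratedFDeriv ℝ n g (t - x)‖) := by ring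
    _ ≤ _ := by
      gcongr
      exact one_add_pow_mul_le_weightedSup le_rfl g _

/-- Mean value inequality on the segment from `t - y` to `t - x`, at the price of one more
derivative. Each point `s` of the segment satisfies `1 + ‖t‖ ≤ (1 + ‖x‖ + ‖y‖)(1 + ‖s‖)`, so the
weight at `t` can be moved to `s`. -/
theorem seminorm_compSubConst_sub_le (k n : ℕ) (x y : V) (g : 𝓢(V, ℂ)) :
    SchwartzMap.seminorm ℝ k n
        (SchwartzMap.compSubConstCLM ℂ x g - SchwartzMap.compSubConstCLM ℂ y g)
      ≤ ‖x - y‖ * ((1 + ‖x‖ + ‖y‖) ^ k * weightedSup k (n + 1) g) := by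
  have hS := weightedSup_nonneg k (n + 1) g
  refine SchwartzMap.seminorm_le_bound ℝ k n _ (by positivity) fun t => ?_
  have h1 : iteratedFDeriv ℝ n
      (⇑(SchwartzMap.compSubConstCLM ℂ x g - SchwartzMap.compSubConstCLM ℂ y g)) t
      = iteratedFDeriv ℝ n g (t - x) - iteratedFDeriv ℝ n g (t - y) := by
    have e1 : iteratedFDeriv ℝ n (SchwartzMap.compSubConstCLM ℂ x g) t
        = iteratedFDeriv ℝ n g (t - x) := iteratedFDeriv_comp_sub n x t
    have e2 : iteratedFDeriv ℝ n (SchwartzMap.compSubConstCLM ℂ y g) t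
        = iteratedFDeriv ℝ n g (t - y) := iteratedFDeriv_comp_sub n y t
    rw [← e1, ← e2]
    exact iteratedFDeriv_sub_apply ((SchwartzMap.smooth _ n).contDiffAt)
      ((SchwartzMap.smooth _ n).contDiffAt)
  rw [h1]
  have hpos : (0 : ℝ) < (1 + ‖t‖) ^ k := by positivity
  have hseg : ∀ s ∈ segment ℝ (t - y) (t - x),
      ‖fderiv ℝ (iteratedFDeriv ℝ n g) s‖
        ≤ (1 + ‖x‖ + ‖y‖) ^ k * weightedSup k (n + 1) g / (1 + ‖t‖) ^ k := by
    rintro s ⟨a, b, ha, hb, hab, rfl⟩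
    rw [norm_fderiv_iteratedFDeriv, le_div_iff₀ hpos]
    set s := a • (t - y) + b • (t - x)
    have hs : s = t - (a • y + b • x) := by
      have : t = a • t + b • t := by rw [← add_smul, hab, one_smul]
      simp only [s, smul_sub]
      nth_rewrite 3 [this]
      abel
    have hw : ‖a • y + b • x‖ ≤ ‖x‖ + ‖y‖ := by
      refine (norm_add_le _ _).trans ?_
      rw [norm_smul, norm_smul, Real.norm_of_nonneg ha, Real.norm_of_nonneg hb]
      nlinarith [norm_nonneg x, norm_nonneg y]
    have ht : 1 + ‖t‖ ≤ (1 + ‖x‖ + ‖y‖) * (1 + ‖s‖) := by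
      refine (one_add_norm_le_mul t (a • y + b • x)).trans ?_
      rw [← hs]
      have : 1 + ‖a • y + b • x‖ ≤ 1 + ‖x‖ + ‖y‖ := by linarith
      gcongr
    calc ‖iteratedFDeriv ℝ (n + 1) g s‖ * (1 + ‖t‖) ^ k
        ≤ ‖iteratedFDeriv ℝ (n + 1) g s‖ * ((1 + ‖x‖ + ‖y‖) * (1 + ‖s‖)) ^ k := by gcongr
      _ = (1 + ‖x‖ + ‖y‖) ^ k * ((1 + ‖s‖) ^ k * ‖iteratedFDeriv ℝ (n + 1) g s‖) := by
        rw [mul_pow]; ring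
      _ ≤ _ := by
        gcongr
        exact one_add_pow_mul_le_weightedSup le_rfl g s
  have hdiff : ∀ s ∈ segment ℝ (t - y) (t - x), DifferentiableAt ℝ (iteratedFDeriv ℝ n g) s :=
    fun s _ => (g.smooth ⊤).differentiable_iteratedFDeriv (m := n)
      (mod_cast ENat.natCast_lt_top n) s
  have h2 := (convex_segment (𝕜 := ℝ) (t - y) (t - x)).norm_image_sub_le_of_norm_fderiv_le
    hdiff hseg (left_mem_segment ℝ _ _) (right_mem_segment ℝ _ _)
  have h3 : ‖(t - x) - (t - y)‖ = ‖x - y‖ := by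
    rw [sub_sub_sub_cancel_left, norm_sub_rev]
  rw [h3] at h2
  calc ‖t‖ ^ k * ‖iteratedFDeriv ℝ n g (t - x) - iteratedFDeriv ℝ n g (t - y)‖
      ≤ (1 + ‖t‖) ^ k * ((1 + ‖x‖ + ‖y‖) ^ k * weightedSup k (n + 1) g / (1 + ‖t‖) ^ k
          * ‖x - y‖) := by
        gcongr
        linarith
    _ = _ := by field_simp

/-- Translation is jointly continuous on the Schwartz space. -/
theorem continuous_compSubConst :
    Continuous fun p : V × 𝓢(V, ℂ) => SchwartzMap.compSubConstCLM ℂ p.1 p.2 := by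
  rw [continuous_iff_continuousAt]
  rintro ⟨x₀, g₀⟩
  refine ((schwartz_withSeminorms ℝ V ℂ).tendsto_nhds _ _).2 fun ⟨k, n⟩ ε hε => ?_
  -- The first term pays for replacing the function by `g₀` under the moving translation, the second
  -- for moving the translation of the fixed `g₀`. Both vanish at the base point.
  let F : V × 𝓢(V, ℂ) → ℝ := fun p => (1 + ‖p.1‖) ^ k * weightedSup k n (p.2 - g₀)
    + ‖p.1 - x₀‖ * ((1 + ‖p.1‖ + ‖x₀‖) ^ k * weightedSup k (n + 1) g₀)
  have hF : Continuous F := by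
    have h := (continuous_weightedSup (V := V) k n).comp
      (continuous_snd.sub continuous_const : Continuous fun p : V × 𝓢(V, ℂ) => p.2 - g₀)
    exact (((continuous_const.add continuous_fst.norm).pow k).mul h).add
      (((continuous_fst.sub continuous_const).norm).mul
        (((continuous_const.add continuous_fst.norm).add continuous_const).pow k
          |>.mul continuous_const))
  have hF0 : F (x₀, g₀) < ε := by simpa [F, weightedSup_zero] using hε
  filter_upwards [hF.continuousAt.eventually_lt continuousAt_const hF0] with p hp
  refine lt_of_le_of_lt ?_ hp
  have hsplit : SchwartzMap.compSubConstCLM ℂ p.1 p.2 - SchwartzMap.compSubConstCLM ℂ x₀ g₀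
      = SchwartzMap.compSubConstCLM ℂ p.1 (p.2 - g₀)
        + (SchwartzMap.compSubConstCLM ℂ p.1 g₀ - SchwartzMap.compSubConstCLM ℂ x₀ g₀) := by
    rw [map_sub]; abel
  rw [hsplit]
  exact (map_add_le_add _ _ _).trans
    (add_le_add (seminorm_compSubConst_le k n _ _) (seminorm_compSubConst_sub_le k n _ _ _))

/-- A family of Schwartz functions all of whose seminorms grow at most polynomially. -/
def HasModerateGrowth {Z : Type*} [Norm Z] (u : Z → 𝓢(V, ℂ)) : Prop :=
  ∀ k n : ℕ, ∃ (C : ℝ) (M : ℕ), 0 ≤ C ∧ ∀ z, SchwartzMap.seminorm ℝ k n (u z) ≤ C * (1 + ‖z‖) ^ M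

variable {Z : Type*} [SeminormedAddCommGroup Z]

theorem hasModerateGrowth_const (g : 𝓢(V, ℂ)) : HasModerateGrowth fun _ : Z => g := fun k n =>
  ⟨SchwartzMap.seminorm ℝ k n g, 0, apply_nonneg _ _, fun z => by simp⟩

theorem HasModerateGrowth.sup {u : Z → 𝓢(V, ℂ)} (hu : HasModerateGrowth u) (s : Finset (ℕ × ℕ)) :
    ∃ (C : ℝ) (M : ℕ), 0 ≤ C ∧
      ∀ z, s.sup (schwartzSeminormFamily ℝ V ℂ) (u z) ≤ C * (1 + ‖z‖) ^ M := by
  induction s using Finset.induction_on with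
  | empty => exact ⟨0, 0, le_rfl, fun z => by simp⟩
  | insert i s hi ih =>
    obtain ⟨C₁, M₁, hC₁, h₁⟩ := ih
    obtain ⟨C₂, M₂, hC₂, h₂⟩ := hu i.1 i.2
    refine ⟨C₁ + C₂, M₁ + M₂, by positivity, fun z => ?_⟩
    have hz : 1 ≤ 1 + ‖z‖ := by linarith [norm_nonneg z]
    have e1 : (1 + ‖z‖) ^ M₁ ≤ (1 + ‖z‖) ^ (M₁ + M₂) := pow_le_pow_right₀ hz (by omega)
    have e2 : (1 + ‖z‖) ^ M₂ ≤ (1 + ‖z‖) ^ (M₁ + M₂) := pow_le_pow_right₀ hz (by omega)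
    rw [Finset.sup_insert, Seminorm.sup_apply]
    refine sup_le ((h₂ z).trans ?_) ((h₁ z).trans ?_)
    · exact mul_le_mul (by linarith) e2 (by positivity) (by positivity)
    · exact mul_le_mul (by linarith) e1 (by positivity) (by positivity)

theorem HasModerateGrowth.clm_comp {u : Z → 𝓢(V, ℂ)} (hu : HasModerateGrowth u)
    (L : 𝓢(V, ℂ) →L[ℝ] 𝓢(V, ℂ)) : HasModerateGrowth fun z => L (u z) := fun k n => by
  obtain ⟨s, C, -, hL⟩ := Seminorm.bound_of_continuous (schwartz_withSeminorms ℝ V ℂ)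
    ((schwartzSeminormFamily ℝ V ℂ (k, n)).comp (L : 𝓢(V, ℂ) →ₗ[ℝ] 𝓢(V, ℂ)))
    (((schwartz_withSeminorms ℝ V ℂ).continuous_seminorm (k, n)).comp L.continuous)
  obtain ⟨C', M, hC', h⟩ := hu.sup s
  refine ⟨C * C', M, by positivity, fun z => (hL (u z)).trans ?_⟩
  change (C : ℝ) * _ ≤ _
  rw [mul_assoc]
  exact mul_le_mul_of_nonneg_left (h z) C.2

theorem HasModerateGrowth.compSubConst {u : Z → 𝓢(V, ℂ)} (hu : HasModerateGrowth u)
    {x : Z → V} (hx : ∀ z, ‖x z‖ ≤ ‖z‖) :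
    HasModerateGrowth fun z => SchwartzMap.compSubConstCLM ℂ (x z) (u z) := fun k n => by
  obtain ⟨C, M, hC, h⟩ := hu.sup (Finset.Iic (k, n))
  refine ⟨2 ^ k * C, k + M, by positivity, fun z => ?_⟩
  refine (seminorm_compSubConst_le k n _ _).trans ?_
  have hz := hx z
  calc (1 + ‖x z‖) ^ k * weightedSup k n (u z)
      ≤ (1 + ‖z‖) ^ k * (2 ^ k * (C * (1 + ‖z‖) ^ M)) := by
        unfold weightedSup
        gcongr
        exact h z
    _ = 2 ^ k * C * (1 + ‖z‖) ^ (k + M) := by ring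

end Translation

/-! ### Time-frequency shifts -/

section Shift

variable {V : Type*} [NormedAddCommGroup V] [InnerProductSpace ℝ V]

theorem norm_tfShift_apply (x ω : V) (g : 𝓢(V, ℂ)) (t : V) :
    ‖tfShift x ω g t‖ = ‖g (t - x)‖ := by
  rw [tfShift_apply, norm_mul, norm_expi, one_mul]

theorem expi_zero : expi 0 = 1 := by simp [expi]

theorem tfShift_zero (g : 𝓢(V, ℂ)) : tfShift 0 0 g = g := by
  ext t
  simp [tfShift_apply, expi_zero]

variable [FiniteDimensional ℝ V] [MeasurableSpace V] [BorelSpace V]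

theorem fourier_apply_eq_integral (f : 𝓢(V, ℂ)) (ω : V) :
    𝓕 f ω = ∫ y : V, expi (-⟪y, ω⟫_ℝ) * f y := by
  rw [SchwartzMap.fourier_coe, Real.fourier_eq']
  refine integral_congr_ae (Filter.Eventually.of_forall fun y => ?_)
  simp only [expi, smul_eq_mul]
  congr 3
  push_cast
  ring

theorem fourierInv_apply_eq_integral (f : 𝓢(V, ℂ)) (ω : V) :
    𝓕⁻ f ω = ∫ y : V, expi ⟪y, ω⟫_ℝ * f y := by
  rw [SchwartzMap.fourierInv_coe, Real.fourierInv_eq']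
  rfl

theorem fourier_tfShift (x ω : V) (g : 𝓢(V, ℂ)) :
    𝓕 (tfShift x ω g)
      = SchwartzMap.compSubConstCLM ℂ ω (𝓕 (SchwartzMap.compSubConstCLM ℂ x g)) := by
  ext ξ
  rw [SchwartzMap.compSubConstCLM_apply, fourier_apply_eq_integral, fourier_apply_eq_integral]
  refine integral_congr_ae (Filter.Eventually.of_forall fun y => ?_)
  simp only [tfShift_apply, SchwartzMap.compSubConstCLM_apply]
  rw [← mul_assoc, ← expi_add]
  congr 2
  rw [inner_sub_right, real_inner_comm ω y]
  ring

theorem fourier_tfShift_apply (x ω : V) (g : 𝓢(V, ℂ)) (ξ : V) :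
    𝓕 (tfShift x ω g) ξ = expi (-⟪x, ξ - ω⟫_ℝ) * 𝓕 g (ξ - ω) := by
  rw [fourier_tfShift, SchwartzMap.compSubConstCLM_apply, fourier_apply_eq_integral,
    fourier_apply_eq_integral, ← integral_const_mul]
  rw [← integral_add_right_eq_self (μ := volume) _ x]
  refine integral_congr_ae (Filter.Eventually.of_forall fun y => ?_)
  simp only [SchwartzMap.compSubConstCLM_apply, add_sub_cancel_right]
  rw [← mul_assoc, ← expi_add, inner_add_left]
  congr 2
  ring

/-- Modulation is translation conjugated by the Fourier transform. Joint continuity and moderate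
growth of time-frequency shifts thus reduce to the same facts for translations. -/
theorem tfShift_eq (x ω : V) (g : 𝓢(V, ℂ)) :
    tfShift x ω g
      = 𝓕⁻ (SchwartzMap.compSubConstCLM ℂ ω (𝓕 (SchwartzMap.compSubConstCLM ℂ x g))) := by
  rw [← fourier_tfShift, FourierTransform.fourierInv_fourier_eq]

theorem continuous_tfShift :
    Continuous fun p : (V × V) × 𝓢(V, ℂ) => tfShift p.1.1 p.1.2 p.2 := by
  simp only [tfShift_eq]
  refine (fourierInvCLM ℂ 𝓢(V, ℂ)).continuous.comp ?_
  refine continuous_compSubConst.comp (continuous_fst.snd.prodMk ?_)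
  refine (fourierCLM ℂ 𝓢(V, ℂ)).continuous.comp ?_
  exact continuous_compSubConst.comp (continuous_fst.fst.prodMk continuous_snd)

theorem continuous_tfShift_left (g : 𝓢(V, ℂ)) :
    Continuous fun z : V × V => tfShift z.1 z.2 g :=
  continuous_tfShift.comp (continuous_id.prodMk continuous_const)

theorem hasModerateGrowth_tfShift (g : 𝓢(V, ℂ)) :
    HasModerateGrowth fun z : V × V => tfShift z.1 z.2 g := by
  simp only [tfShift_eq]
  exact ((((hasModerateGrowth_const g).compSubConst (x := fun z : V × V => z.1) norm_fst_le).clm_comp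
    ((fourierCLM ℂ 𝓢(V, ℂ)).restrictScalars ℝ)).compSubConst
      (x := fun z : V × V => z.2) norm_snd_le).clm_comp
        ((fourierInvCLM ℂ 𝓢(V, ℂ)).restrictScalars ℝ)

theorem bracket_coe (ψ φ : 𝓢(V, ℂ)) :
    bracket (ψ : 𝓢'(V, ℂ)) φ = ∫ t, ψ t * conj (φ t) := by
  rw [bracket, SchwartzMap.coe_apply]
  exact integral_congr_ae (Filter.Eventually.of_forall fun t => by simp [mul_comm])

theorem bracket_fourier_coe (ψ φ : 𝓢(V, ℂ)) :
    bracket ((𝓕 ψ : 𝓢(V, ℂ)) : 𝓢'(V, ℂ)) (𝓕 φ) = bracket (ψ : 𝓢'(V, ℂ)) φ := by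
  rw [bracket_coe, bracket_coe]
  have h := SchwartzMap.integral_inner_fourier_fourier φ ψ
  simpa [RCLike.inner_apply] using h

theorem integrable_one_add_pow_mul_norm (N : ℕ) (ψ : 𝓢(V, ℂ)) :
    Integrable fun t => (1 + ‖t‖) ^ N * ‖ψ t‖ := by
  have h1 := ((ψ.integrable (μ := volume)).norm.add (ψ.integrable_pow_mul volume N)).const_mul
    (2 ^ (N - 1) : ℝ)
  refine h1.mono' (by fun_prop) (Filter.Eventually.of_forall fun t => ?_)
  rw [Real.norm_of_nonneg (by positivity)]
  have h2 := add_pow_le (zero_le_one (α := ℝ)) (norm_nonneg t) N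
  calc (1 + ‖t‖) ^ N * ‖ψ t‖ ≤ (2 ^ (N - 1) * (1 ^ N + ‖t‖ ^ N)) * ‖ψ t‖ := by gcongr
    _ = _ := by
      simp only [Pi.add_apply]
      ring

/-- The weight `(1 + ‖x‖)ᴺ` is split between `ψ` at `t` and `g` at `t - x`. Only the modulus of `u`
enters, so the estimate applies both to a time-frequency shift and to its Fourier transform. -/
theorem norm_bracket_coe_le (N : ℕ) (ψ u g : 𝓢(V, ℂ)) (x : V) (hu : ∀ t, ‖u t‖ = ‖g (t - x)‖) :
    (1 + ‖x‖) ^ N * ‖bracket (ψ : 𝓢'(V, ℂ)) u‖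
      ≤ (∫ t, (1 + ‖t‖) ^ N * ‖ψ t‖) * weightedSup N 0 g := by
  rw [bracket_coe, ← integral_mul_const]
  have h := norm_integral_le_of_norm_le
    (f := fun t => ((1 + ‖x‖) ^ N : ℝ) • (ψ t * conj (u t)))
    ((integrable_one_add_pow_mul_norm N ψ).mul_const (weightedSup N 0 g))
    (Filter.Eventually.of_forall fun t => by
      rw [norm_smul, norm_mul, RCLike.norm_conj, hu, Real.norm_of_nonneg (by positivity)]
      have h1 : (1 + ‖x‖) ^ N ≤ (1 + ‖t‖) ^ N * (1 + ‖t - x‖) ^ N := by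
        rw [← mul_pow, norm_sub_rev]
        exact pow_le_pow_left₀ (by positivity) (one_add_norm_le_mul x t) N
      calc (1 + ‖x‖) ^ N * (‖ψ t‖ * ‖g (t - x)‖)
          ≤ ((1 + ‖t‖) ^ N * (1 + ‖t - x‖) ^ N) * (‖ψ t‖ * ‖g (t - x)‖) := by gcongr
        _ = (1 + ‖t‖) ^ N * ‖ψ t‖ * ((1 + ‖t - x‖) ^ N * ‖g (t - x)‖) := by ring
        _ ≤ _ := by
          gcongr
          exact one_add_pow_mul_norm_le_weightedSup N g _)
  rwa [integral_smul, norm_smul, Real.norm_of_nonneg (by positivity)] at h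

/-- A continuous size functional on windows which controls the decay of short-time
Fourier transforms. -/
def windowSize (N : ℕ) (g : 𝓢(V, ℂ)) : ℝ := weightedSup N 0 g + weightedSup N 0 (𝓕 g)

theorem windowSize_nonneg (N : ℕ) (g : 𝓢(V, ℂ)) : 0 ≤ windowSize N g :=
  add_nonneg (weightedSup_nonneg _ _ _) (weightedSup_nonneg _ _ _)

theorem windowSize_zero (N : ℕ) : windowSize N (0 : 𝓢(V, ℂ)) = 0 := by
  have h : 𝓕 (0 : 𝓢(V, ℂ)) = 0 := (fourierCLM ℂ 𝓢(V, ℂ)).map_zero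
  simp [windowSize, weightedSup_zero, h]

theorem continuous_windowSize (N : ℕ) : Continuous (windowSize N : 𝓢(V, ℂ) → ℝ) :=
  (continuous_weightedSup N 0).add
    ((continuous_weightedSup N 0).comp (fourierCLM ℂ 𝓢(V, ℂ)).continuous)

/-- Rapid decay of the short-time Fourier transform of a Schwartz function. -/
theorem exists_norm_stft_coe_le (N : ℕ) (ψ : 𝓢(V, ℂ)) :
    ∃ C : ℝ, 0 ≤ C ∧ ∀ (g : 𝓢(V, ℂ)) (z : V × V),
      ‖stft g (ψ : 𝓢'(V, ℂ)) z.1 z.2‖ ≤ C * windowSize N g * ((1 + ‖z‖) ^ N)⁻¹ := by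
  have hI : ∀ φ : 𝓢(V, ℂ), 0 ≤ ∫ t, (1 + ‖t‖) ^ N * ‖φ t‖ := fun φ =>
    integral_nonneg fun t => by positivity
  refine ⟨(∫ t, (1 + ‖t‖) ^ N * ‖ψ t‖) + ∫ t, (1 + ‖t‖) ^ N * ‖𝓕 ψ t‖,
    add_nonneg (hI _) (hI _), fun g z => ?_⟩
  have h1 := norm_bracket_coe_le N ψ (tfShift z.1 z.2 g) g z.1 (norm_tfShift_apply _ _ _)
  have h2 := norm_bracket_coe_le N (𝓕 ψ) (𝓕 (tfShift z.1 z.2 g)) (𝓕 g) z.2 (fun ξ => by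
    rw [fourier_tfShift_apply, norm_mul, norm_expi, one_mul])
  rw [bracket_fourier_coe] at h2
  rw [← div_eq_mul_inv, le_div_iff₀ (by positivity), mul_comm, stft]
  have a1 := weightedSup_nonneg N 0 g
  have a2 := weightedSup_nonneg N 0 (𝓕 g)
  have b1 := hI ψ
  have b2 := hI (𝓕 ψ)
  unfold windowSize
  -- `h1` gives decay in time and `h2`, through Parseval, decay in frequency. The norm on `V × V` is
  -- the maximum, so the larger coordinate suffices.
  rcases le_total ‖z.1‖ ‖z.2‖ with h | h
  · rw [show ‖z‖ = ‖z.2‖ from max_eq_right h]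
    refine h2.trans ?_
    nlinarith [mul_nonneg b1 a1, mul_nonneg b1 a2, mul_nonneg b2 a1]
  · rw [show ‖z‖ = ‖z.1‖ from max_eq_left h]
    refine h1.trans ?_
    nlinarith [mul_nonneg b2 a2, mul_nonneg b1 a2, mul_nonneg b2 a1]

end Shift

/-! ### Polynomial decay -/

section Decay

variable {E : Type*} [NormedAddCommGroup E]

/-- The weight `(1 + ‖x‖)⁻ᴺ`. -/
def decay (N : ℕ) (x : E) : ℝ≥0∞ := ENNReal.ofReal (((1 + ‖x‖) ^ N)⁻¹)

theorem decay_anti {F : Type*} [NormedAddCommGroup F] (N : ℕ) {x : E} {y : F} (h : ‖x‖ ≤ ‖y‖) :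
    decay N y ≤ decay N x := by
  unfold decay
  gcongr

theorem decay_prod_le {F : Type*} [NormedAddCommGroup F] (N : ℕ) (p : E × F) :
    decay (N + N) p ≤ decay N p.1 * decay N p.2 := by
  unfold decay
  rw [← ENNReal.ofReal_mul (by positivity), ← mul_inv, pow_add]
  have h1 := norm_fst_le p
  have h2 := norm_snd_le p
  gcongr

variable [MeasurableSpace E] [BorelSpace E]

theorem measurable_decay (N : ℕ) : Measurable (decay N : E → ℝ≥0∞) := by
  unfold decay
  fun_prop

variable [NormedSpace ℝ E] [FiniteDimensional ℝ E] {μ : Measure E} [μ.IsAddHaarMeasure]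

theorem integrable_inv_one_add_norm_pow {N : ℕ} (hN : Module.finrank ℝ E < N) :
    Integrable (fun x : E => ((1 + ‖x‖) ^ N)⁻¹) μ := by
  have h := integrable_one_add_norm (E := E) (μ := μ) (r := N) (mod_cast hN)
  refine h.congr (Filter.Eventually.of_forall fun x => ?_)
  simp only
  rw [Real.rpow_neg (by positivity), Real.rpow_natCast]

theorem lintegral_decay_lt_top {N : ℕ} (hN : Module.finrank ℝ E < N) :
    ∫⁻ x, decay N x ∂μ < ∞ := by
  have h := (integrable_inv_one_add_norm_pow (μ := μ) hN).hasFiniteIntegral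
  rw [hasFiniteIntegral_iff_norm] at h
  refine lt_of_le_of_lt (lintegral_mono fun x => ?_) h
  exact ENNReal.ofReal_le_ofReal (le_abs_self _)

end Decay

/-! ### The inversion formula for the short-time Fourier transform -/

section Inversion

variable {V : Type*} [NormedAddCommGroup V] [InnerProductSpace ℝ V]

/-- The pairing with a tempered distribution as a real-linear functional. -/
def bracketCLM (f : 𝓢'(V, ℂ)) : 𝓢(V, ℂ) →L[ℝ] ℂ :=
  ((show 𝓢(V, ℂ) →L[ℂ] ℂ from f).restrictScalars ℝ) ∘L
    SchwartzMap.postcompCLM (𝕜 := ℝ) (Complex.conjCLE : ℂ →L[ℝ] ℂ)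

theorem bracketCLM_apply (f : 𝓢'(V, ℂ)) (h : 𝓢(V, ℂ)) : bracketCLM f h = bracket f h := rfl

theorem bracket_smul (f : 𝓢'(V, ℂ)) (c : ℂ) (h : 𝓢(V, ℂ)) :
    bracket f (c • h) = conj c * bracket f h := by
  have e : conjS (c • h) = conj c • conjS h := by
    ext t
    simp
  rw [bracket, e, map_smul, smul_eq_mul, bracket]

theorem conjS_conjS (h : 𝓢(V, ℂ)) : conjS (conjS h) = h := by
  ext t
  simp

theorem bracket_injective {u v : 𝓢'(V, ℂ)} (h : ∀ g, bracket u g = bracket v g) : u = v := by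
  ext g
  simpa only [bracket, conjS_conjS] using h (conjS g)

/-- The product `ψ · conj (g(· - x))`. -/
def windowed (ψ g : 𝓢(V, ℂ)) (x : V) : 𝓢(V, ℂ) :=
  SchwartzMap.smulLeftCLM ℂ (conjS (SchwartzMap.compSubConstCLM ℂ x g)) ψ

theorem windowed_apply (ψ g : 𝓢(V, ℂ)) (x t : V) :
    windowed ψ g x t = conj (g (t - x)) * ψ t := by
  rw [windowed, SchwartzMap.smulLeftCLM_apply_apply (SchwartzMap.hasTemperateGrowth _), conjS_apply,
    SchwartzMap.compSubConstCLM_apply, smul_eq_mul]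

variable [FiniteDimensional ℝ V]

theorem finrank_lt_decay_exponent :
    Module.finrank ℝ (V × V) < 2 * Module.finrank ℝ V + 1 := by
  rw [Module.finrank_prod]
  omega

variable [MeasurableSpace V] [BorelSpace V]

theorem continuous_stft (g : 𝓢(V, ℂ)) (f : 𝓢'(V, ℂ)) :
    Continuous fun z : V × V => stft g f z.1 z.2 :=
  (bracketCLM f).continuous.comp (continuous_tfShift_left g)

/-- The squared `L²` norm of a window. -/
def energy (g : 𝓢(V, ℂ)) : ℝ := ∫ t, ‖g t‖ ^ 2

theorem integrable_norm_sq (g : 𝓢(V, ℂ)) : Integrable fun t => ‖g t‖ ^ 2 := by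
  have h := (g.memLp 2).integrable_norm_pow (by norm_num)
  simpa using h

theorem energy_pos {g : 𝓢(V, ℂ)} (hg : g ≠ 0) : 0 < energy g := by
  obtain ⟨t, ht⟩ : ∃ t, g t ≠ 0 := by
    by_contra! h
    exact hg (SchwartzMap.ext h)
  have hc : Continuous fun t => ‖g t‖ ^ 2 := by fun_prop
  exact integral_pos_of_integrable_nonneg_nonzero hc (integrable_norm_sq g)
    (fun t => by positivity) (x := t) (by simpa using ht)

instance isAddHaarMeasure_volume_prod : (volume : Measure (V × V)).IsAddHaarMeasure :=
  Measure.prod.instIsAddHaarMeasure (volume : Measure V) volume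

theorem norm_stft_coe_smul_seminorm_integrable (ψ g : 𝓢(V, ℂ)) (k n : ℕ) :
    Integrable fun z : V × V => SchwartzMap.seminorm ℝ k n
      (stft g (ψ : 𝓢'(V, ℂ)) z.1 z.2 • tfShift z.1 z.2 g) := by
  obtain ⟨C, M, hC, hM⟩ := hasModerateGrowth_tfShift g k n
  -- The power `M` absorbs the growth of the shifts; the remaining exponent exceeds `dim (V × V)`
  -- and makes the weight integrable.
  obtain ⟨D, hD, hdec⟩ := exists_norm_stft_coe_le (M + (2 * Module.finrank ℝ V + 1)) ψ
  have hcont : Continuous fun z : V × V =>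
      stft g (ψ : 𝓢'(V, ℂ)) z.1 z.2 • tfShift z.1 z.2 g :=
    (continuous_stft g _).smul (continuous_tfShift_left g)
  refine ((integrable_inv_one_add_norm_pow (finrank_lt_decay_exponent (V := V))).const_mul
    (D * windowSize (M + (2 * Module.finrank ℝ V + 1)) g * C)).mono'
    (((schwartz_withSeminorms ℝ V ℂ).continuous_seminorm (k, n)).comp
      hcont).aestronglyMeasurable (Filter.Eventually.of_forall fun z => ?_)
  rw [Real.norm_of_nonneg (apply_nonneg _ _)]
  have h1 : SchwartzMap.seminorm ℝ k n (stft g (ψ : 𝓢'(V, ℂ)) z.1 z.2 • tfShift z.1 z.2 g)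
      = ‖stft g (ψ : 𝓢'(V, ℂ)) z.1 z.2‖ * SchwartzMap.seminorm ℝ k n (tfShift z.1 z.2 g) :=
    map_smul_eq_mul (SchwartzMap.seminorm ℂ k n) _ _
  rw [h1]
  have hw := windowSize_nonneg (M + (2 * Module.finrank ℝ V + 1)) g
  calc ‖stft g (ψ : 𝓢'(V, ℂ)) z.1 z.2‖ * SchwartzMap.seminorm ℝ k n (tfShift z.1 z.2 g)
      ≤ (D * windowSize (M + (2 * Module.finrank ℝ V + 1)) g
          * ((1 + ‖z‖) ^ (M + (2 * Module.finrank ℝ V + 1)))⁻¹) * (C * (1 + ‖z‖) ^ M) := by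
        gcongr
        · exact hdec g z
        · exact hM z
    _ = _ := by
      have : (1 + ‖z‖) ≠ 0 := by positivity
      rw [pow_add]
      field_simp

theorem stft_coe_eq_fourier (ψ g : 𝓢(V, ℂ)) (x ω : V) :
    stft g (ψ : 𝓢'(V, ℂ)) x ω = 𝓕 (windowed ψ g x) ω := by
  rw [stft, bracket_coe, fourier_apply_eq_integral]
  refine integral_congr_ae (Filter.Eventually.of_forall fun t => ?_)
  simp only [tfShift_apply, windowed_apply, map_mul, conj_expi, real_inner_comm]
  ring

/-- The pointwise inversion formula for Schwartz functions. -/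
theorem energy_smul_apply_eq_integral (ψ g : 𝓢(V, ℂ)) (t : V) :
    ((energy g : ℂ) • ψ) t
      = ∫ z : V × V, (stft g (ψ : 𝓢'(V, ℂ)) z.1 z.2 • tfShift z.1 z.2 g) t := by
  have hcont : Continuous fun z : V × V =>
      stft g (ψ : 𝓢'(V, ℂ)) z.1 z.2 • tfShift z.1 z.2 g :=
    (continuous_stft g _).smul (continuous_tfShift_left g)
  have hint : Integrable (fun z : V × V =>
      (stft g (ψ : 𝓢'(V, ℂ)) z.1 z.2 • tfShift z.1 z.2 g) t) := by
    have h := integrable_iteratedFDeriv_apply hcont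
      (norm_stft_coe_smul_seminorm_integrable ψ g) 0 t
    refine h.norm.mono' ?_ (Filter.Eventually.of_forall fun z => ?_)
    · exact ((BoundedContinuousFunction.evalCLM ℂ t).continuous.comp
        ((SchwartzMap.toBoundedContinuousFunctionCLM ℂ V ℂ).continuous.comp
          hcont)).aestronglyMeasurable
    · rw [norm_iteratedFDeriv_zero]
  rw [Measure.volume_eq_prod] at hint ⊢
  rw [integral_prod _ hint]
  -- For fixed `x` the frequency integral is Fourier inversion of the windowed function; the
  -- integral over `x` then only sees `|g(t - x)|²`.
  have hinner : ∀ x : V, ∫ ω : V, (stft g (ψ : 𝓢'(V, ℂ)) x ω • tfShift x ω g) t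
      = ψ t * ((‖g (t - x)‖ ^ 2 : ℝ) : ℂ) := by
    intro x
    have h : 𝓕⁻ (𝓕 (windowed ψ g x)) t = windowed ψ g x t := by
      rw [FourierTransform.fourierInv_fourier_eq]
    rw [fourierInv_apply_eq_integral, windowed_apply] at h
    have h2 : ψ t * ((‖g (t - x)‖ ^ 2 : ℝ) : ℂ) = conj (g (t - x)) * ψ t * g (t - x) := by
      rw [Complex.ofReal_pow, ← Complex.conj_mul']
      ring
    rw [h2, ← h, ← integral_mul_const]
    refine integral_congr_ae (Filter.Eventually.of_forall fun ω => ?_)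
    simp only [_root_.smul_apply, smul_eq_mul, tfShift_apply, stft_coe_eq_fourier]
    ring
  simp only [hinner]
  rw [integral_const_mul, integral_complex_ofReal,
    integral_sub_left_eq_self (fun x => ‖g x‖ ^ 2) volume t]
  simp [energy, mul_comm]

/-- The inversion formula tested against a continuous functional. -/
theorem clm_energy_smul_eq_integral (L : 𝓢(V, ℂ) →L[ℝ] ℂ) (ψ g : 𝓢(V, ℂ)) :
    Integrable (fun z : V × V => L (stft g (ψ : 𝓢'(V, ℂ)) z.1 z.2 • tfShift z.1 z.2 g)) ∧
    L ((energy g : ℂ) • ψ)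
      = ∫ z : V × V, L (stft g (ψ : 𝓢'(V, ℂ)) z.1 z.2 • tfShift z.1 z.2 g) :=
  integral_comp_schwartz ((continuous_stft g _).smul (continuous_tfShift_left g))
    (norm_stft_coe_smul_seminorm_integrable ψ g) (energy_smul_apply_eq_integral ψ g) L

theorem energy_mul_clm_eq_integral (B : 𝓢(V, ℂ) →L[ℂ] ℂ) (ψ g : 𝓢(V, ℂ)) :
    Integrable (fun z : V × V => stft g (ψ : 𝓢'(V, ℂ)) z.1 z.2 * B (tfShift z.1 z.2 g)) ∧
    (energy g : ℂ) * B ψ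
      = ∫ z : V × V, stft g (ψ : 𝓢'(V, ℂ)) z.1 z.2 * B (tfShift z.1 z.2 g) := by
  have h := clm_energy_smul_eq_integral (B.restrictScalars ℝ) ψ g
  simpa using h

theorem energy_mul_bracket_eq_integral (f : 𝓢'(V, ℂ)) (ψ g : 𝓢(V, ℂ)) :
    (energy g : ℂ) * bracket f ψ
      = ∫ z : V × V, stft g f z.1 z.2 * conj (stft g (ψ : 𝓢'(V, ℂ)) z.1 z.2) := by
  have h := (clm_energy_smul_eq_integral (bracketCLM f) ψ g).2
  simp only [bracketCLM_apply, bracket_smul, Complex.conj_ofReal] at h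
  rw [h]
  exact integral_congr_ae (Filter.Eventually.of_forall fun z => mul_comm _ _)

theorem conj_bracket_coe (ψ φ : 𝓢(V, ℂ)) :
    conj (bracket (ψ : 𝓢'(V, ℂ)) φ) = bracket (φ : 𝓢'(V, ℂ)) ψ := by
  rw [bracket_coe, bracket_coe, ← integral_conj]
  exact integral_congr_ae (Filter.Eventually.of_forall fun t => by simp [mul_comm])

/-- Covariance: up to a phase, the transform of a shifted window depends only on `w - z`. This turns
the reproducing formula into domination by a convolution. -/
theorem stft_tfShift_coe (g₁ g₂ : 𝓢(V, ℂ)) (z w : V × V) :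
    stft g₂ (tfShift z.1 z.2 g₁ : 𝓢'(V, ℂ)) w.1 w.2
      = expi ⟪z.2 - w.2, z.1⟫_ℝ * stft g₂ (g₁ : 𝓢'(V, ℂ)) (w - z).1 (w - z).2 := by
  rw [stft, stft, bracket_coe, bracket_coe, ← integral_const_mul,
    ← integral_add_right_eq_self (μ := volume) _ z.1]
  refine integral_congr_ae (Filter.Eventually.of_forall fun t => ?_)
  simp only [tfShift_apply, map_mul, conj_expi, add_sub_cancel_right, Prod.fst_sub, Prod.snd_sub]
  have e1 : t + z.1 - w.1 = t - (w.1 - z.1) := by abel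
  have e2 : expi ⟪z.2, t + z.1⟫_ℝ * expi (-⟪w.2, t + z.1⟫_ℝ)
      = expi ⟪z.2 - w.2, z.1⟫_ℝ * expi (-⟪w.2 - z.2, t⟫_ℝ) := by
    rw [← expi_add, ← expi_add]
    congr 1
    simp only [inner_add_right, inner_sub_left]
    ring
  rw [e1]
  linear_combination (g₁ t * conj (g₂ (t - (w.1 - z.1)))) * e2

/-- The reproducing formula for a change of windows. -/
theorem energy_mul_stft_eq_integral (f : 𝓢'(V, ℂ)) (g₁ g₂ : 𝓢(V, ℂ)) (w : V × V) :
    (energy g₁ : ℂ) * stft g₂ f w.1 w.2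
      = ∫ z : V × V, stft g₁ f z.1 z.2 * stft g₂ (tfShift z.1 z.2 g₁ : 𝓢'(V, ℂ)) w.1 w.2 := by
  rw [stft, energy_mul_bracket_eq_integral]
  refine integral_congr_ae (Filter.Eventually.of_forall fun z => ?_)
  simp only [stft, conj_bracket_coe]

/-- Short-time Fourier transforms with different windows are pointwise dominated by convolutions. -/
theorem exists_enorm_stft_le (N : ℕ) {g₁ : 𝓢(V, ℂ)} (hg₁ : g₁ ≠ 0) :
    ∃ C : ℝ, 0 ≤ C ∧ ∀ (g₂ : 𝓢(V, ℂ)) (f : 𝓢'(V, ℂ)) (w : V × V),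
      ‖stft g₂ f w.1 w.2‖ₑ ≤ ENNReal.ofReal (C * windowSize N g₂)
        * ∫⁻ z : V × V, ‖stft g₁ f z.1 z.2‖ₑ * decay N (w - z) := by
  obtain ⟨C, hC, hdec⟩ := exists_norm_stft_coe_le N g₁
  have hE := energy_pos hg₁
  refine ⟨(energy g₁)⁻¹ * C, by positivity, fun g₂ f w => ?_⟩
  have hw := windowSize_nonneg N g₂
  have h1 : stft g₂ f w.1 w.2 = ((energy g₁)⁻¹ : ℝ) •
      ∫ z : V × V, stft g₁ f z.1 z.2 * stft g₂ (tfShift z.1 z.2 g₁ : 𝓢'(V, ℂ)) w.1 w.2 := by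
    rw [← energy_mul_stft_eq_integral, Complex.real_smul, ← mul_assoc, ← Complex.ofReal_mul,
      inv_mul_cancel₀ hE.ne']
    simp
  rw [h1, enorm_smul, Real.enorm_of_nonneg (by positivity), mul_assoc,
    ENNReal.ofReal_mul (by positivity : 0 ≤ (energy g₁)⁻¹), mul_assoc]
  gcongr
  refine (enorm_integral_le_lintegral_enorm _).trans ?_
  rw [← lintegral_const_mul' _ _ ENNReal.ofReal_ne_top]
  refine lintegral_mono fun z => ?_
  rw [enorm_mul, mul_left_comm]
  gcongr
  rw [stft_tfShift_coe, enorm_mul, decay, ← ENNReal.ofReal_mul (by positivity)]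
  have h2 : ‖expi ⟪z.2 - w.2, z.1⟫_ℝ‖ₑ = 1 := by
    rw [← ofReal_norm, norm_expi, ENNReal.ofReal_one]
  rw [h2, one_mul, ← ofReal_norm]
  exact ENNReal.ofReal_le_ofReal (hdec g₂ (w - z))

end Inversion

/-! ### Mixed norms -/

section MixedNorm

variable {V : Type*} [NormedAddCommGroup V] [InnerProductSpace ℝ V] [FiniteDimensional ℝ V]
  [MeasurableSpace V] [BorelSpace V]

/-- Tonelli with the first variable integrated first, where `K` is constant. This is how an
`L^∞(L^1)` function pairs with a kernel that is integrable in the second variable only. -/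
theorem lintegral_mul_snd_le {F : V × V → ℝ≥0∞} (hF : Measurable F) {K : V → ℝ≥0∞}
    (hK : Measurable K) {N : ℝ≥0∞} (hN : ∀ᵐ b : V, ∫⁻ a : V, F (a, b) ≤ N) :
    ∫⁻ q : V × V, F q * K q.2 ≤ N * ∫⁻ b, K b := by
  have hFK : Measurable fun q : V × V => F q * K q.2 := hF.mul (hK.comp measurable_snd)
  rw [Measure.volume_eq_prod, lintegral_prod_symm _ hFK.aemeasurable,
    ← lintegral_const_mul _ hK]
  refine lintegral_mono_ae (hN.mono fun b hb => ?_)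
  have hFb : Measurable fun a : V => F (a, b) := hF.comp measurable_prodMk_right
  simp only
  rw [lintegral_mul_const _ hFb]
  gcongr

/-- Young's inequality for the mixed norm `L^∞(L^1)`. -/
theorem lintegral_convolution_le {F m : V × V → ℝ≥0∞} (hF : Measurable F) (hm : Measurable m)
    {N : ℝ≥0∞} (hN : ∀ᵐ b : V, ∫⁻ a : V, F (a, b) ≤ N) (b : V) :
    ∫⁻ a : V, ∫⁻ q : V × V, F q * m ((a, b) - q) ≤ N * ∫⁻ q, m q := by
  have hm2 : Measurable fun p : V × (V × V) => m ((p.1, b) - p.2) :=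
    hm.comp ((measurable_fst.prodMk measurable_const).sub measurable_snd)
  rw [lintegral_lintegral_swap ((hF.comp measurable_snd).mul hm2).aemeasurable]
  have h1 : ∀ q : V × V, ∫⁻ a : V, F q * m ((a, b) - q) = F q * ∫⁻ a, m (a, b - q.2) := by
    intro q
    have hm3 : Measurable fun a : V => m ((a, b) - q) :=
      hm.comp ((measurable_id.prodMk measurable_const).sub measurable_const)
    rw [lintegral_const_mul _ hm3]
    congr 1
    exact lintegral_sub_right_eq_self (fun a => m (a, b - q.2)) q.1
  simp only [h1]
  have hK : Measurable fun c : V => ∫⁻ a : V, m (a, c) := hm.lintegral_prod_left'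
  refine (lintegral_mul_snd_le hF (K := fun c => ∫⁻ a, m (a, b - c))
    (hK.comp (measurable_const.sub measurable_id)) hN).trans_eq ?_
  rw [lintegral_sub_left_eq_self (fun c => ∫⁻ a, m (a, c)) b, Measure.volume_eq_prod,
    lintegral_prod_symm _ hm.aemeasurable]

/-- The norm `‖b ↦ ‖V_g f(e(·, b))‖_{L^1}‖_{L^∞}`. -/
def mixedNorm (e : (V × V) ≃ₗᵢ[ℝ] (V × V)) (g : 𝓢(V, ℂ)) (f : 𝓢'(V, ℂ)) : ℝ≥0∞ :=
  eLpNorm (fun b : V => eLpNorm (fun a : V => stft g f (e (a, b)).1 (e (a, b)).2) 1 volume) ∞ volume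

variable {e : (V × V) ≃ₗᵢ[ℝ] (V × V)}

theorem ae_lintegral_le_mixedNorm (g : 𝓢(V, ℂ)) (f : 𝓢'(V, ℂ)) :
    ∀ᵐ b : V, ∫⁻ a : V, ‖stft g f (e (a, b)).1 (e (a, b)).2‖ₑ ≤ mixedNorm e g f := by
  have h := enorm_ae_le_eLpNormEssSup
    (fun b : V => eLpNorm (fun a : V => stft g f (e (a, b)).1 (e (a, b)).2) 1 volume) volume
  filter_upwards [h] with b hb
  rw [← eLpNorm_one_eq_lintegral_enorm, mixedNorm, eLpNorm_exponent_top]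
  exact hb

theorem mixedNorm_le {g : 𝓢(V, ℂ)} {f : 𝓢'(V, ℂ)} {K : ℝ≥0∞}
    (h : ∀ b : V, ∫⁻ a : V, ‖stft g f (e (a, b)).1 (e (a, b)).2‖ₑ ≤ K) :
    mixedNorm e g f ≤ K := by
  rw [mixedNorm, eLpNorm_exponent_top]
  refine eLpNormEssSup_le_of_ae_enorm_bound (Filter.Eventually.of_forall fun b => ?_)
  rw [eLpNorm_one_eq_lintegral_enorm]
  exact h b

theorem measurable_enorm_stft (g : 𝓢(V, ℂ)) (f : 𝓢'(V, ℂ)) :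
    Measurable fun z : V × V => ‖stft g f z.1 z.2‖ₑ :=
  (continuous_stft g f).enorm.measurable

theorem measurable_enorm_stft_comp (g : 𝓢(V, ℂ)) (f : 𝓢'(V, ℂ)) :
    Measurable fun q : V × V => ‖stft g f (e q).1 (e q).2‖ₑ :=
  (measurable_enorm_stft g f).comp e.continuous.measurable

/-- The convolution of a short-time Fourier transform with a decaying weight. -/
def smoothed (N : ℕ) (g : 𝓢(V, ℂ)) (f : 𝓢'(V, ℂ)) (w : V × V) : ℝ≥0∞ :=
  ∫⁻ z : V × V, ‖stft g f z.1 z.2‖ₑ * decay N (w - z)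

theorem measurable_smoothed (N : ℕ) (g : 𝓢(V, ℂ)) (f : 𝓢'(V, ℂ)) :
    Measurable (smoothed N g f) := by
  have h : Measurable fun p : (V × V) × (V × V) =>
      ‖stft g f p.2.1 p.2.2‖ₑ * decay N (p.1 - p.2) :=
    ((measurable_enorm_stft g f).comp measurable_snd).mul
      ((measurable_decay N).comp (measurable_fst.sub measurable_snd))
  exact h.lintegral_prod_right'

theorem lintegral_smoothed_le (he : MeasurePreserving e) (N : ℕ) (g : 𝓢(V, ℂ)) (f : 𝓢'(V, ℂ))
    (b : V) :
    ∫⁻ a : V, smoothed N g f (e (a, b)) ≤ mixedNorm e g f * ∫⁻ q : V × V, decay N q := by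
  refine le_trans (le_of_eq ?_) (lintegral_convolution_le (measurable_enorm_stft_comp g f)
    (measurable_decay N) (ae_lintegral_le_mixedNorm (e := e) g f) b)
  refine lintegral_congr fun a => ?_
  rw [smoothed, ← he.lintegral_comp_emb e.toHomeomorph.measurableEmbedding]
  refine lintegral_congr fun q => ?_
  rw [← map_sub]
  simp only [decay, e.norm_map]

/-- Changing the window costs a convolution with an integrable weight, bounded on `L^∞(L^1)` by
Young. It is needed because `IsImage` quantifies over all nonzero windows while the norm uses one.
-/
theorem mixedNorm_lt_top (he : MeasurePreserving e) {g₁ : 𝓢(V, ℂ)} (hg₁ : g₁ ≠ 0)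
    {f : 𝓢'(V, ℂ)} (hf : mixedNorm e g₁ f < ∞) (g₂ : 𝓢(V, ℂ)) : mixedNorm e g₂ f < ∞ := by
  obtain ⟨C, hC, h⟩ := exists_enorm_stft_le (2 * Module.finrank ℝ V + 1) hg₁
  refine lt_of_le_of_lt (mixedNorm_le (K := ENNReal.ofReal (C * windowSize (2 * Module.finrank ℝ V + 1) g₂) *
    (mixedNorm e g₁ f * ∫⁻ q : V × V, decay (2 * Module.finrank ℝ V + 1) q)) fun b => ?_) ?_
  · refine (lintegral_mono fun a => h g₂ f (e (a, b))).trans ?_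
    rw [lintegral_const_mul' _ _ ENNReal.ofReal_ne_top]
    gcongr
    exact lintegral_smoothed_le he _ g₁ f b
  · exact ENNReal.mul_lt_top ENNReal.ofReal_lt_top
      (ENNReal.mul_lt_top hf (lintegral_decay_lt_top finrank_lt_decay_exponent))

theorem mixedNorm_coe_lt_top (g ψ : 𝓢(V, ℂ)) : mixedNorm e g (ψ : 𝓢'(V, ℂ)) < ∞ := by
  obtain ⟨C, hC, h⟩ := exists_norm_stft_coe_le (Module.finrank ℝ V + 1) ψ
  refine lt_of_le_of_lt (mixedNorm_le (K := ENNReal.ofReal (C * windowSize (Module.finrank ℝ V + 1) g) *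
    ∫⁻ a : V, decay (Module.finrank ℝ V + 1) a) fun b => ?_)
    (ENNReal.mul_lt_top ENNReal.ofReal_lt_top (lintegral_decay_lt_top (Nat.lt_succ_self _)))
  rw [← lintegral_const_mul' _ _ ENNReal.ofReal_ne_top]
  refine lintegral_mono fun a => ?_
  have hw := windowSize_nonneg (Module.finrank ℝ V + 1) g
  calc ‖stft g (ψ : 𝓢'(V, ℂ)) (e (a, b)).1 (e (a, b)).2‖ₑ
      ≤ ENNReal.ofReal (C * windowSize (Module.finrank ℝ V + 1) g)
          * decay (Module.finrank ℝ V + 1) (e (a, b)) := by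
        rw [decay, ← ENNReal.ofReal_mul (by positivity), ← ofReal_norm]
        exact ENNReal.ofReal_le_ofReal (h g (e (a, b)))
    _ ≤ _ := by
        gcongr
        -- Since `‖e (a, b)‖ = ‖(a, b)‖ ≥ ‖a‖`, decay in phase space gives a bound in `a` uniform in
        -- `b`.
        refine decay_anti _ ?_
        rw [e.norm_map]
        exact norm_fst_le (a, b)

end MixedNorm

/-! ### Operators with dominated kernels -/

section Operator

variable {V : Type*} [NormedAddCommGroup V] [InnerProductSpace ℝ V] [FiniteDimensional ℝ V]
  [MeasurableSpace V] [BorelSpace V]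

/-- The time-frequency kernel `⟨A π(e q) g, π(e p) h⟩` of the operator `A` is dominated by an
integrable function of the first component of `p` and the second component of `q`. -/
structure HasDominatedKernel (A : 𝓢(V, ℂ) → 𝓢'(V, ℂ)) (e : (V × V) ≃ₗᵢ[ℝ] (V × V))
    (H : V × V → ℝ≥0∞) : Prop where
  measurable : Measurable H
  lintegral_lt_top : ∫⁻ p, H p < ∞
  lintegral_zero_lt_top : ∫⁻ b, H (0, b) < ∞
  exists_clm : ∀ h : 𝓢(V, ℂ), ∃ B : 𝓢(V, ℂ) →L[ℂ] ℂ, ∀ ψ, bracket (A ψ) h = B ψ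
  exists_bound : ∀ g : 𝓢(V, ℂ), ∃ Q : 𝓢(V, ℂ) → ℝ, Continuous Q ∧ Q 0 = 0 ∧
    ∀ (h : 𝓢(V, ℂ)) (p q : V × V),
      ‖bracket (A (tfShift (e q).1 (e q).2 g)) (tfShift (e p).1 (e p).2 h)‖ₑ
        ≤ ENNReal.ofReal (Q h) * H (p.1, q.2)

namespace HasDominatedKernel

variable {A : 𝓢(V, ℂ) → 𝓢'(V, ℂ)} {e : (V × V) ≃ₗᵢ[ℝ] (V × V)} {H : V × V → ℝ≥0∞}

theorem continuous_kernel (hA : HasDominatedKernel A e H) (g h : 𝓢(V, ℂ)) :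
    Continuous fun z : V × V => bracket (A (tfShift z.1 z.2 g)) h := by
  obtain ⟨B, hB⟩ := hA.exists_clm h
  simp only [hB]
  exact B.continuous.comp (continuous_tfShift_left g)

/-- After the change of variables `z = e q`, the kernel bound ignores `q.1`, so the mixed norm of
`f` factors out. The result depends on `p` only through `p.1`. -/
theorem lintegral_enorm_mul_le (hA : HasDominatedKernel A e H) (he : MeasurePreserving e)
    {g : 𝓢(V, ℂ)} {Q : 𝓢(V, ℂ) → ℝ}
    (hQ : ∀ (h : 𝓢(V, ℂ)) (p q : V × V),
      ‖bracket (A (tfShift (e q).1 (e q).2 g)) (tfShift (e p).1 (e p).2 h)‖ₑ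
        ≤ ENNReal.ofReal (Q h) * H (p.1, q.2))
    (f : 𝓢'(V, ℂ)) (h : 𝓢(V, ℂ)) (p : V × V) :
    ∫⁻ z : V × V, ‖stft g f z.1 z.2
        * bracket (A (tfShift z.1 z.2 g)) (tfShift (e p).1 (e p).2 h)‖ₑ
      ≤ ENNReal.ofReal (Q h) * (mixedNorm e g f * ∫⁻ b, H (p.1, b)) := by
  rw [← he.lintegral_comp_emb e.toHomeomorph.measurableEmbedding]
  have hH : Measurable fun b : V => H (p.1, b) := hA.measurable.comp measurable_prodMk_left
  refine le_trans ?_ (mul_le_mul_right (lintegral_mul_snd_le (measurable_enorm_stft_comp g f) hH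
    (ae_lintegral_le_mixedNorm (e := e) g f)) (ENNReal.ofReal (Q h)))
  rw [← lintegral_const_mul' _ _ ENNReal.ofReal_ne_top]
  refine lintegral_mono fun q => ?_
  rw [enorm_mul, mul_left_comm]
  gcongr
  exact hQ h p q

/-- The case `p = 0`, in which the test function is not shifted; this is where the slice of `H` over
`0` enters. -/
theorem lintegral_enorm_mul_zero_le (hA : HasDominatedKernel A e H) (he : MeasurePreserving e)
    {g : 𝓢(V, ℂ)} {Q : 𝓢(V, ℂ) → ℝ}
    (hQ : ∀ (h : 𝓢(V, ℂ)) (p q : V × V),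
      ‖bracket (A (tfShift (e q).1 (e q).2 g)) (tfShift (e p).1 (e p).2 h)‖ₑ
        ≤ ENNReal.ofReal (Q h) * H (p.1, q.2))
    (f : 𝓢'(V, ℂ)) (h : 𝓢(V, ℂ)) :
    ∫⁻ z : V × V, ‖stft g f z.1 z.2 * bracket (A (tfShift z.1 z.2 g)) h‖ₑ
      ≤ ENNReal.ofReal (Q h) * (mixedNorm e g f * ∫⁻ b, H (0, b)) := by
  simpa [tfShift_zero] using hA.lintegral_enorm_mul_le he hQ f h 0

theorem integrable_mul (hA : HasDominatedKernel A e H) (he : MeasurePreserving e)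
    {g : 𝓢(V, ℂ)} {f : 𝓢'(V, ℂ)} (hf : mixedNorm e g f < ∞) (h : 𝓢(V, ℂ)) :
    Integrable fun z : V × V => stft g f z.1 z.2 * bracket (A (tfShift z.1 z.2 g)) h := by
  obtain ⟨Q, -, -, hQ⟩ := hA.exists_bound g
  refine ⟨((continuous_stft g f).mul (hA.continuous_kernel g h)).aestronglyMeasurable, ?_⟩
  exact lt_of_le_of_lt (hA.lintegral_enorm_mul_zero_le he hQ f h)
    (ENNReal.mul_lt_top ENNReal.ofReal_lt_top (ENNReal.mul_lt_top hf hA.lintegral_zero_lt_top))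

theorem continuous_expi : Continuous expi := expi_hasTemperateGrowth.1.continuous

/-- Justifies Fubini for the change of windows. Integrating over `z` first replaces `|V_{g₁} f|` by
its smoothing, which still has a finite `L^∞(L^1)` norm and can be paired with the slice of `H`. -/
theorem integrable_double (hA : HasDominatedKernel A e H) (he : MeasurePreserving e)
    {g₁ : 𝓢(V, ℂ)} {f : 𝓢'(V, ℂ)} (hf : mixedNorm e g₁ f < ∞) (g₂ h : 𝓢(V, ℂ)) :
    Integrable (Function.uncurry fun z w : V × V => stft g₁ f z.1 z.2 *
      (stft g₂ (tfShift z.1 z.2 g₁ : 𝓢'(V, ℂ)) w.1 w.2 * bracket (A (tfShift w.1 w.2 g₂)) h))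
      (volume.prod volume) := by
  obtain ⟨Q, -, -, hQ⟩ := hA.exists_bound g₂
  set N := 2 * Module.finrank ℝ V + 1
  obtain ⟨C, hC, hdec⟩ := exists_norm_stft_coe_le N g₁
  have hcont : Continuous (Function.uncurry fun z w : V × V => stft g₁ f z.1 z.2 *
      (stft g₂ (tfShift z.1 z.2 g₁ : 𝓢'(V, ℂ)) w.1 w.2
        * bracket (A (tfShift w.1 w.2 g₂)) h)) := by
    simp only [stft_tfShift_coe]
    have h1 := (continuous_stft g₁ f).comp (continuous_fst (X := V × V) (Y := V × V))
    have h2 := (continuous_stft g₂ (g₁ : 𝓢'(V, ℂ))).comp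
      ((continuous_snd (X := V × V) (Y := V × V)).sub continuous_fst)
    have h3 := (hA.continuous_kernel g₂ h).comp (continuous_snd (X := V × V) (Y := V × V))
    have h4 : Continuous fun p : (V × V) × (V × V) => expi ⟪p.1.2 - p.2.2, p.1.1⟫_ℝ :=
      continuous_expi.comp (by fun_prop)
    exact h1.mul ((h4.mul h2).mul h3)
  refine ⟨hcont.aestronglyMeasurable, ?_⟩
  rw [hasFiniteIntegral_def, lintegral_prod_symm _ hcont.enorm.measurable.aemeasurable]
  have hc := windowSize_nonneg N g₂
  have hinner : ∀ w : V × V, ∫⁻ z : V × V, ‖stft g₁ f z.1 z.2 *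
      (stft g₂ (tfShift z.1 z.2 g₁ : 𝓢'(V, ℂ)) w.1 w.2 * bracket (A (tfShift w.1 w.2 g₂)) h)‖ₑ
      ≤ ENNReal.ofReal (C * windowSize N g₂) *
        (smoothed N g₁ f w * ‖bracket (A (tfShift w.1 w.2 g₂)) h‖ₑ) := by
    intro w
    rw [smoothed, ← lintegral_mul_const' _ _ enorm_ne_top,
      ← lintegral_const_mul' _ _ ENNReal.ofReal_ne_top]
    refine lintegral_mono fun z => ?_
    have h1 : ‖stft g₂ (tfShift z.1 z.2 g₁ : 𝓢'(V, ℂ)) w.1 w.2‖ₑ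
        ≤ ENNReal.ofReal (C * windowSize N g₂) * decay N (w - z) := by
      have h2 : ‖expi ⟪z.2 - w.2, z.1⟫_ℝ‖ₑ = 1 := by
        rw [← ofReal_norm, norm_expi, ENNReal.ofReal_one]
      rw [stft_tfShift_coe, enorm_mul, decay, ← ENNReal.ofReal_mul (by positivity), h2, one_mul,
        ← ofReal_norm]
      exact ENNReal.ofReal_le_ofReal (hdec g₂ (w - z))
    rw [enorm_mul, enorm_mul]
    calc _ ≤ ‖stft g₁ f z.1 z.2‖ₑ * ((ENNReal.ofReal (C * windowSize N g₂) * decay N (w - z))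
          * ‖bracket (A (tfShift w.1 w.2 g₂)) h‖ₑ) := by gcongr
      _ = _ := by ring
  refine lt_of_le_of_lt (lintegral_mono hinner) ?_
  rw [lintegral_const_mul' _ _ ENNReal.ofReal_ne_top]
  refine ENNReal.mul_lt_top ENNReal.ofReal_lt_top ?_
  rw [← he.lintegral_comp_emb e.toHomeomorph.measurableEmbedding]
  have hbound : ∀ q : V × V, ‖bracket (A (tfShift (e q).1 (e q).2 g₂)) h‖ₑ
      ≤ ENNReal.ofReal (Q h) * H (0, q.2) := by
    intro q
    simpa [tfShift_zero] using hQ h 0 q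
  have hH : Measurable fun b : V => H (0, b) := hA.measurable.comp measurable_prodMk_left
  refine lt_of_le_of_lt (lintegral_mono (g := fun q => ENNReal.ofReal (Q h) *
    (smoothed N g₁ f (e q) * H (0, q.2))) fun q => ?_) ?_
  · simp only
    rw [mul_left_comm]
    gcongr
    exact hbound q
  · rw [lintegral_const_mul' _ _ ENNReal.ofReal_ne_top]
    refine ENNReal.mul_lt_top ENNReal.ofReal_lt_top ?_
    refine lt_of_le_of_lt (lintegral_mul_snd_le
      ((measurable_smoothed N g₁ f).comp e.continuous.measurable) hH
      (Filter.Eventually.of_forall fun b => lintegral_smoothed_le he N g₁ f b)) ?_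
    exact ENNReal.mul_lt_top (ENNReal.mul_lt_top hf
      (lintegral_decay_lt_top finrank_lt_decay_exponent)) hA.lintegral_zero_lt_top

/-- The weak integral defining the canonical extension does not depend on the window. -/
theorem energy_mul_integral_eq (hA : HasDominatedKernel A e H) (he : MeasurePreserving e)
    {g₁ : 𝓢(V, ℂ)} {f : 𝓢'(V, ℂ)} (hf : mixedNorm e g₁ f < ∞) (g₂ h : 𝓢(V, ℂ)) :
    (energy g₂ : ℂ) * ∫ z : V × V, stft g₁ f z.1 z.2 * bracket (A (tfShift z.1 z.2 g₁)) h
      = (energy g₁ : ℂ) *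
        ∫ w : V × V, stft g₂ f w.1 w.2 * bracket (A (tfShift w.1 w.2 g₂)) h := by
  obtain ⟨B, hB⟩ := hA.exists_clm h
  have hswap := integral_integral_swap (hA.integrable_double he hf g₂ h)
  simp only [hB] at hswap ⊢
  rw [← integral_const_mul, ← integral_const_mul]
  -- Expand `π(z)g₁` in shifts of `g₂` under the functional `B`, exchange the integrals, and
  -- recognise the reproducing formula for `V_{g₂} f`.
  calc _ = ∫ z : V × V, ∫ w : V × V, stft g₁ f z.1 z.2 *
        (stft g₂ (tfShift z.1 z.2 g₁ : 𝓢'(V, ℂ)) w.1 w.2 * B (tfShift w.1 w.2 g₂)) := by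
        refine integral_congr_ae (Filter.Eventually.of_forall fun z => ?_)
        simp only
        rw [integral_const_mul, ← (energy_mul_clm_eq_integral B (tfShift z.1 z.2 g₁) g₂).2]
        ring
    _ = _ := hswap
    _ = _ := by
        refine integral_congr_ae (Filter.Eventually.of_forall fun w => ?_)
        simp only
        rw [← mul_assoc, energy_mul_stft_eq_integral, ← integral_mul_const]
        refine integral_congr_ae (Filter.Eventually.of_forall fun z => ?_)
        simp only
        ring

/-- The functional `φ ↦ ∫ V_g f(z) (A π(z) g)(φ) dz`. -/
theorem exists_distribution (hA : HasDominatedKernel A e H) (he : MeasurePreserving e)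
    {g : 𝓢(V, ℂ)} {f : 𝓢'(V, ℂ)} (hf : mixedNorm e g f < ∞) :
    ∃ u : 𝓢'(V, ℂ), ∀ h, bracket u h
      = ∫ z : V × V, stft g f z.1 z.2 * bracket (A (tfShift z.1 z.2 g)) h := by
  obtain ⟨Q, hQc, hQ0, hQ⟩ := hA.exists_bound g
  have hint : ∀ φ : 𝓢(V, ℂ), Integrable fun z : V × V =>
      stft g f z.1 z.2 * A (tfShift z.1 z.2 g) φ := fun φ => by
    simpa only [bracket, conjS_conjS] using hA.integrable_mul he hf (conjS φ)
  let u : 𝓢(V, ℂ) →ₗ[ℂ] ℂ :=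
    { toFun := fun φ => ∫ z : V × V, stft g f z.1 z.2 * A (tfShift z.1 z.2 g) φ
      map_add' := fun φ₁ φ₂ => by
        rw [← integral_add (hint φ₁) (hint φ₂)]
        simp only [map_add, mul_add]
      map_smul' := fun c φ => by
        rw [RingHom.id_apply, smul_eq_mul, ← integral_const_mul]
        simp only [map_smul, smul_eq_mul]
        exact integral_congr_ae (Filter.Eventually.of_forall fun z => by ring) }
  set K : ℝ≥0∞ := mixedNorm e g f * ∫⁻ b, H (0, b)
  have hK : K ≠ ∞ := (ENNReal.mul_lt_top hf hA.lintegral_zero_lt_top).ne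
  have hbound : ∀ φ, ‖u φ‖ₑ ≤ ENNReal.ofReal (Q (conjS φ)) * K := fun φ => by
    refine (enorm_integral_le_lintegral_enorm _).trans ?_
    simpa only [bracket, conjS_conjS] using hA.lintegral_enorm_mul_zero_le he hQ f (conjS φ)
  have hconj : Continuous (conjS : 𝓢(V, ℂ) → 𝓢(V, ℂ)) :=
    (SchwartzMap.postcompCLM (𝕜 := ℝ) (Complex.conjCLE : ℂ →L[ℝ] ℂ)).continuous
  -- By linearity continuity at `0` is enough, and there the bound tends to `0` because `Q` is
  -- continuous with `Q 0 = 0`.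
  have hu : Continuous u := by
    refine continuous_of_continuousAt_zero u ?_
    rw [ContinuousAt, map_zero, tendsto_zero_iff_enorm_tendsto_zero]
    have h0 : conjS (0 : 𝓢(V, ℂ)) = 0 := by ext t; simp
    have h1 : Filter.Tendsto (fun φ : 𝓢(V, ℂ) => ENNReal.ofReal (Q (conjS φ)) * K)
        (nhds 0) (nhds 0) := by
      have h2 := (ENNReal.continuous_ofReal.comp (hQc.comp hconj)).tendsto (0 : 𝓢(V, ℂ))
      have h3 := ENNReal.Tendsto.mul_const h2 (Or.inr hK)
      simpa [h0, hQ0] using h3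
    exact tendsto_of_tendsto_of_tendsto_of_le_of_le tendsto_const_nhds h1
      (fun _ => zero_le) hbound
  exact ⟨ContinuousLinearMap.toPointwiseConvergenceCLM _ _ _ _ ⟨u, hu⟩, fun h => rfl⟩

/-- The image is built with the single window `φ`; window independence gives the formula for every
other `g`. -/
theorem exists_isImage (hA : HasDominatedKernel A e H) (he : MeasurePreserving e)
    {φ : 𝓢(V, ℂ)} (hφ : φ ≠ 0) {f : 𝓢'(V, ℂ)} (hf : mixedNorm e φ f < ∞) :
    ∃ u, IsImage A f u := by
  obtain ⟨u, hu⟩ := hA.exists_distribution he hf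
  refine ⟨((energy φ : ℂ)⁻¹) • u, fun g hg h =>
    ⟨hA.integrable_mul he (mixedNorm_lt_top he hφ hf g) h, ?_⟩⟩
  have hE₁ : (energy φ : ℂ) ≠ 0 := mod_cast (energy_pos hφ).ne'
  have hE₂ : (energy g : ℂ) ≠ 0 := mod_cast (energy_pos hg).ne'
  have h1 := hA.energy_mul_integral_eq he hf g h
  have h2 : bracket ((energy φ : ℂ)⁻¹ • u) h = (energy φ : ℂ)⁻¹ * bracket u h := rfl
  rw [h2, hu h]
  change _ = (energy g : ℂ)⁻¹ * _
  field_simp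
  linear_combination h1

end HasDominatedKernel

theorem IsImage.unique {A : 𝓢(V, ℂ) → 𝓢'(V, ℂ)} {φ : 𝓢(V, ℂ)} (hφ : φ ≠ 0) {f u v : 𝓢'(V, ℂ)}
    (hu : IsImage A f u) (hv : IsImage A f v) : u = v :=
  bracket_injective fun h => (hu φ hφ h).2.trans (hv φ hφ h).2.symm

theorem IsImage.add {A : 𝓢(V, ℂ) → 𝓢'(V, ℂ)} {f₁ f₂ u₁ u₂ : 𝓢'(V, ℂ)}
    (h₁ : IsImage A f₁ u₁) (h₂ : IsImage A f₂ u₂) : IsImage A (f₁ + f₂) (u₁ + u₂) := by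
  intro g hg h
  obtain ⟨i₁, e₁⟩ := h₁ g hg h
  obtain ⟨i₂, e₂⟩ := h₂ g hg h
  have hs : (fun z : V × V => stft g (f₁ + f₂) z.1 z.2 * bracket (A (tfShift z.1 z.2 g)) h)
      = fun z : V × V => stft g f₁ z.1 z.2 * bracket (A (tfShift z.1 z.2 g)) h
        + stft g f₂ z.1 z.2 * bracket (A (tfShift z.1 z.2 g)) h := by
    funext z
    rw [← add_mul]
    rfl
  have hb : bracket (u₁ + u₂) h = bracket u₁ h + bracket u₂ h := rfl
  rw [hs, hb, e₁, e₂, ← mul_add, integral_add i₁ i₂]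
  exact ⟨i₁.add i₂, rfl⟩

theorem IsImage.smul {A : 𝓢(V, ℂ) → 𝓢'(V, ℂ)} (c : ℂ) {f u : 𝓢'(V, ℂ)}
    (h₁ : IsImage A f u) : IsImage A (c • f) (c • u) := by
  intro g hg h
  obtain ⟨i₁, e₁⟩ := h₁ g hg h
  have hs : (fun z : V × V => stft g (c • f) z.1 z.2 * bracket (A (tfShift z.1 z.2 g)) h)
      = fun z : V × V => c * (stft g f z.1 z.2 * bracket (A (tfShift z.1 z.2 g)) h) := by
    funext z
    rw [← mul_assoc]
    rfl
  have hb : bracket (c • u) h = c * bracket u h := rfl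
  rw [hs, hb, e₁, integral_const_mul]
  exact ⟨i₁.const_mul c, by ring⟩

/-- The inversion formula tested against `ψ ↦ ⟨Aψ, h⟩`, which is continuous and linear by
`exists_clm`. -/
theorem HasDominatedKernel.isImage_coe {A : 𝓢(V, ℂ) → 𝓢'(V, ℂ)} {e : (V × V) ≃ₗᵢ[ℝ] (V × V)}
    {H : V × V → ℝ≥0∞} (hA : HasDominatedKernel A e H) (f : 𝓢(V, ℂ)) :
    IsImage A (f : 𝓢'(V, ℂ)) (A f) := by
  intro g hg h
  obtain ⟨B, hB⟩ := hA.exists_clm h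
  obtain ⟨h1, h2⟩ := energy_mul_clm_eq_integral B f g
  simp only [hB]
  refine ⟨h1, ?_⟩
  have hE : (energy g : ℂ) ≠ 0 := mod_cast (energy_pos hg).ne'
  rw [← h2]
  change _ = (energy g : ℂ)⁻¹ * _
  field_simp

open Classical in
/-- The canonical extension of `A` to those distributions which have an image. -/
def canonicalExtension (A : 𝓢(V, ℂ) → 𝓢'(V, ℂ)) (f : 𝓢'(V, ℂ)) : 𝓢'(V, ℂ) :=
  if h : ∃ u, IsImage A f u then h.choose else 0

theorem isImage_canonicalExtension {A : 𝓢(V, ℂ) → 𝓢'(V, ℂ)} {f : 𝓢'(V, ℂ)}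
    (h : ∃ u, IsImage A f u) : IsImage A f (canonicalExtension A f) := by
  rw [canonicalExtension, dif_pos h]
  exact h.choose_spec

theorem canonicalExtension_eq {A : 𝓢(V, ℂ) → 𝓢'(V, ℂ)} {φ : 𝓢(V, ℂ)} (hφ : φ ≠ 0)
    {f u : 𝓢'(V, ℂ)} (h : IsImage A f u) : canonicalExtension A f = u :=
  (isImage_canonicalExtension ⟨u, h⟩).unique hφ h

/-- An operator with a dominated kernel extends to a bounded operator for the mixed norm. -/
theorem HasDominatedKernel.isBoundedOperator {A : 𝓢(V, ℂ) → 𝓢'(V, ℂ)}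
    {e : (V × V) ≃ₗᵢ[ℝ] (V × V)} {H : V × V → ℝ≥0∞} (hA : HasDominatedKernel A e H)
    (he : MeasurePreserving e) {φ : 𝓢(V, ℂ)} (hφ : φ ≠ 0) :
    IsBoundedOperator A (mixedNorm e φ) (canonicalExtension A) where
  extends_schwartz f := ⟨mixedNorm_coe_lt_top φ f, canonicalExtension_eq hφ (hA.isImage_coe f)⟩
  isImage f hf := isImage_canonicalExtension (hA.exists_isImage he hφ hf)
  map_add f₁ f₂ h₁ h₂ := canonicalExtension_eq hφ <|
    (isImage_canonicalExtension (hA.exists_isImage he hφ h₁)).add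
      (isImage_canonicalExtension (hA.exists_isImage he hφ h₂))
  map_smul c f hf := canonicalExtension_eq hφ <|
    (isImage_canonicalExtension (hA.exists_isImage he hφ hf)).smul c
  bounded := by
    obtain ⟨Q, -, -, hQ⟩ := hA.exists_bound φ
    have hE := energy_pos hφ
    set K : ℝ≥0∞ := ENNReal.ofReal (energy φ)⁻¹ * (ENNReal.ofReal (Q φ) * ∫⁻ p, H p)
    have hK : K ≠ ∞ := (ENNReal.mul_lt_top ENNReal.ofReal_lt_top
      (ENNReal.mul_lt_top ENNReal.ofReal_lt_top hA.lintegral_lt_top)).ne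
    refine ⟨K.toNNReal, fun f hf => ?_⟩
    rw [ENNReal.coe_toNNReal hK]
    refine mixedNorm_le fun b => ?_
    -- The right-hand side is free of `b`; integrating it over `a` produces the full integral of
    -- `H`.
    have hpt : ∀ a : V, ‖stft φ (canonicalExtension A f) (e (a, b)).1 (e (a, b)).2‖ₑ
        ≤ ENNReal.ofReal (energy φ)⁻¹ *
          (ENNReal.ofReal (Q φ) * (mixedNorm e φ f * ∫⁻ c, H (a, c))) := by
      intro a
      rw [stft, (isImage_canonicalExtension (hA.exists_isImage he hφ hf) φ hφ _).2, enorm_mul]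
      have h1 : ‖(((∫ t : V, ‖φ t‖ ^ 2 : ℝ) : ℂ))⁻¹‖ₑ = ENNReal.ofReal (energy φ)⁻¹ := by
        rw [← ofReal_norm, norm_inv, Complex.norm_real]
        change ENNReal.ofReal ‖energy φ‖⁻¹ = _
        rw [Real.norm_of_nonneg hE.le]
      rw [h1]
      gcongr
      exact (enorm_integral_le_lintegral_enorm _).trans
        (hA.lintegral_enorm_mul_le he hQ f φ (a, b))
    refine (lintegral_mono hpt).trans_eq ?_
    have hm : Measurable fun a : V => ∫⁻ c : V, H (a, c) := hA.measurable.lintegral_prod_right'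
    rw [lintegral_const_mul' _ _ ENNReal.ofReal_ne_top,
      lintegral_const_mul' _ _ ENNReal.ofReal_ne_top, lintegral_const_mul' _ _ hf.ne,
      ← lintegral_prod _ hA.measurable.aemeasurable, ← Measure.volume_eq_prod]
    simp only [K]
    ring

end Operator

/-! ### Symbols in the Wiener amalgam space -/

section Envelope

variable {V : Type*} [NormedAddCommGroup V] [InnerProductSpace ℝ V] [FiniteDimensional ℝ V]
  [MeasurableSpace V] [BorelSpace V]

/-- The essential supremum of the short-time Fourier transform over all frequencies. -/
def supStft (g : 𝓢(V, ℂ)) (f : 𝓢'(V, ℂ)) (x : V) : ℝ≥0∞ :=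
  eLpNorm (fun ω : V => stft g f x ω) ∞ volume

/-- A continuous function attains no value above its essential supremum, since sets of full measure
are dense. Hence the kernel bound holds at every frequency, and `supStft` is lower semicontinuous,
hence measurable. -/
theorem supStft_eq_iSup (g : 𝓢(V, ℂ)) (f : 𝓢'(V, ℂ)) (x : V) :
    supStft g f x = ⨆ ω : V, ‖stft g f x ω‖ₑ := by
  have hc : Continuous fun ω : V => ‖stft g f x ω‖ₑ :=
    ((continuous_stft g f).comp (continuous_const.prodMk continuous_id)).enorm
  rw [supStft, eLpNorm_exponent_top]
  refine le_antisymm (eLpNormEssSup_le_of_ae_enorm_bound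
    (Filter.Eventually.of_forall fun ω => le_iSup (fun ω : V => ‖stft g f x ω‖ₑ) ω))
    (iSup_le fun ω => ?_)
  have hae := enorm_ae_le_eLpNormEssSup (fun ω : V => stft g f x ω) volume
  have hd : Dense {ω : V | ‖stft g f x ω‖ₑ ≤ eLpNormEssSup (fun ω : V => stft g f x ω) volume} :=
    Measure.dense_of_ae hae
  have hcl : IsClosed {ω : V |
      ‖stft g f x ω‖ₑ ≤ eLpNormEssSup (fun ω : V => stft g f x ω) volume} :=
    isClosed_le hc continuous_const
  have huniv := hd.closure_eq
  rw [hcl.closure_eq] at huniv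
  exact huniv.symm.subset (Set.mem_univ ω)

theorem enorm_stft_le_supStft (g : 𝓢(V, ℂ)) (f : 𝓢'(V, ℂ)) (x ω : V) :
    ‖stft g f x ω‖ₑ ≤ supStft g f x := by
  rw [supStft_eq_iSup]
  exact le_iSup (fun ω : V => ‖stft g f x ω‖ₑ) ω

theorem measurable_supStft (g : 𝓢(V, ℂ)) (f : 𝓢'(V, ℂ)) : Measurable (supStft g f) := by
  have h : supStft g f = fun x => ⨆ ω : V, ‖stft g f x ω‖ₑ := funext (supStft_eq_iSup g f)
  rw [h]
  refine (lowerSemicontinuous_iSup fun ω => Continuous.lowerSemicontinuous ?_).measurable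
  exact ((continuous_stft g f).comp (continuous_id.prodMk continuous_const)).enorm

theorem lintegral_supStft_lt_top {g : 𝓢(V, ℂ)} {f : 𝓢'(V, ℂ)}
    (hf : f ∈ wienerAmalgamSpace g ∞ 1) : ∫⁻ x, supStft g f x < ∞ := by
  have h : wienerAmalgamNorm g ∞ 1 f < ∞ := hf
  rwa [wienerAmalgamNorm, eLpNorm_one_eq_lintegral_enorm] at h

/-- The convolution of `supStft g f` with a decaying weight. -/
def envelope (N : ℕ) (g : 𝓢(V, ℂ)) (f : 𝓢'(V, ℂ)) (x : V) : ℝ≥0∞ :=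
  ∫⁻ y : V, supStft g f y * decay N (x - y)

theorem measurable_envelope_kernel (N : ℕ) (g : 𝓢(V, ℂ)) (f : 𝓢'(V, ℂ)) :
    Measurable fun p : V × V => supStft g f p.2 * decay N (p.1 - p.2) :=
  ((measurable_supStft g f).comp measurable_snd).mul
    ((measurable_decay N).comp (measurable_fst.sub measurable_snd))

theorem measurable_envelope (N : ℕ) (g : 𝓢(V, ℂ)) (f : 𝓢'(V, ℂ)) :
    Measurable (envelope N g f) :=
  (measurable_envelope_kernel N g f).lintegral_prod_right'

theorem lintegral_envelope_lt_top {N : ℕ} (hN : Module.finrank ℝ V < N) {g : 𝓢(V, ℂ)}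
    {f : 𝓢'(V, ℂ)} (hf : f ∈ wienerAmalgamSpace g ∞ 1) : ∫⁻ x, envelope N g f x < ∞ := by
  have h1 : ∫⁻ x, envelope N g f x = (∫⁻ y, supStft g f y) * ∫⁻ x : V, decay N x := by
    unfold envelope
    rw [lintegral_lintegral_swap (measurable_envelope_kernel N g f).aemeasurable,
      ← lintegral_mul_const _ (measurable_supStft g f)]
    refine lintegral_congr fun y => ?_
    have hm : Measurable fun x : V => decay N (x - y) :=
      (measurable_decay N).comp (measurable_id.sub measurable_const)
    rw [lintegral_const_mul _ hm, lintegral_sub_right_eq_self (fun x : V => decay N x) y]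
  rw [h1]
  exact ENNReal.mul_lt_top (lintegral_supStft_lt_top hf) (lintegral_decay_lt_top hN)

/-- Decay of order `N + N` on the product splits into order `N` in each variable. Once the transform
is replaced by its supremum over frequencies, the frequency weight integrates to a constant. -/
theorem smoothed_le_envelope (N : ℕ) (g : 𝓢(V, ℂ)) (f : 𝓢'(V, ℂ)) (w : V × V) :
    smoothed (N + N) g f w ≤ envelope N g f w.1 * ∫⁻ ω : V, decay N ω := by
  have hm2 : Measurable fun c : V => decay N (w.2 - c) :=
    (measurable_decay N).comp (measurable_const.sub measurable_id)
  have hm : Measurable fun z : V × V =>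
      (supStft g f z.1 * decay N (w.1 - z.1)) * decay N (w.2 - z.2) :=
    (((measurable_supStft g f).comp measurable_fst).mul
      ((measurable_decay N).comp (measurable_const.sub measurable_fst))).mul
        (hm2.comp measurable_snd)
  have hm1 : Measurable fun y : V => supStft g f y * decay N (w.1 - y) :=
    (measurable_supStft g f).mul ((measurable_decay N).comp (measurable_const.sub measurable_id))
  have h1 : smoothed (N + N) g f w ≤ ∫⁻ z : V × V,
      (supStft g f z.1 * decay N (w.1 - z.1)) * decay N (w.2 - z.2) := by
    refine lintegral_mono fun z => ?_
    rw [mul_assoc]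
    exact mul_le_mul' (enorm_stft_le_supStft g f z.1 z.2) (decay_prod_le N (w - z))
  refine h1.trans (le_of_eq ?_)
  rw [Measure.volume_eq_prod, lintegral_prod _ hm.aemeasurable, envelope,
    ← lintegral_mul_const _ hm1]
  refine lintegral_congr fun y => ?_
  simp only
  rw [lintegral_const_mul _ hm2, lintegral_sub_left_eq_self (fun c : V => decay N c) w.2]

/-- All short-time Fourier transforms of `f` are dominated, uniformly in the frequency,
by the envelope of `f`. -/
theorem exists_enorm_stft_le_envelope {N : ℕ} (hN : Module.finrank ℝ V < N) {g₁ : 𝓢(V, ℂ)}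
    (hg₁ : g₁ ≠ 0) : ∃ C : ℝ, 0 ≤ C ∧ ∀ (g₂ : 𝓢(V, ℂ)) (f : 𝓢'(V, ℂ)) (x ω : V),
      ‖stft g₂ f x ω‖ₑ ≤ ENNReal.ofReal (C * windowSize (N + N) g₂) * envelope N g₁ f x := by
  obtain ⟨C, hC, h⟩ := exists_enorm_stft_le (N + N) hg₁
  have hD : ∫⁻ ω : V, decay N ω ≠ ∞ := (lintegral_decay_lt_top hN).ne
  refine ⟨(∫⁻ ω : V, decay N ω).toReal * C, by positivity, fun g₂ f x ω => ?_⟩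
  refine (h g₂ f (x, ω)).trans ?_
  rw [mul_assoc, ENNReal.ofReal_mul ENNReal.toReal_nonneg, ENNReal.ofReal_toReal hD]
  calc _ ≤ ENNReal.ofReal (C * windowSize (N + N) g₂)
        * (envelope N g₁ f x * ∫⁻ ω : V, decay N ω) := by
        gcongr
        exact smoothed_le_envelope N g₁ f (x, ω)
    _ = _ := by ring

end Envelope

/-! ### The kernels of Kohn-Nirenberg operators -/

section Symbol

variable {d : ℕ}

theorem norm_ofLp_le (X : PhaseSpace d) : ‖WithLp.ofLp X‖ ≤ ‖X‖ :=
  max_le (WithLp.norm_fst_le _ X) (WithLp.norm_snd_le _ X)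

theorem inner_phaseSpace (X Y : PhaseSpace d) :
    ⟪X, Y⟫_ℝ = ⟪X.fst, Y.fst⟫_ℝ + ⟪X.snd, Y.snd⟫_ℝ := WithLp.prod_inner_apply X Y

/-- `W_0` sees `h` in time and `ĝ` in frequency, so the new position combines the time shift of `h`
with the frequency shift of `g`. The remaining phases, including those from translating the chirp,
are affine in `X` and form a modulation and a constant. -/
theorem rihaczek_tfShift (h g : 𝓢(Space d, ℂ)) (w z : Space d × Space d) :
    rihaczek (tfShift w.1 w.2 h) (tfShift z.1 z.2 g)
      = expi (⟪w.1, z.2⟫_ℝ - ⟪z.1, z.2⟫_ℝ) •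
        tfShift (WithLp.toLp 2 (w.1, z.2) : PhaseSpace d) (WithLp.toLp 2 (w.2 - z.2, z.1 - w.1))
          (rihaczek h g) := by
  ext X
  rw [_root_.smul_apply, smul_eq_mul, tfShift_apply, rihaczek_apply, rihaczek_apply, tfShift_apply,
    fourier_tfShift_apply]
  simp only [chirp, map_mul, conj_expi, neg_neg, inner_phaseSpace, WithLp.sub_fst, WithLp.sub_snd,
    WithLp.toLp_fst, WithLp.toLp_snd]
  have key : expi (-1 * ⟪X.fst, X.snd⟫_ℝ) * expi ⟪w.2, X.fst⟫_ℝ * expi ⟪z.1, X.snd - z.2⟫_ℝ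
      = expi (⟪w.1, z.2⟫_ℝ - ⟪z.1, z.2⟫_ℝ)
        * expi (⟪w.2 - z.2, X.fst⟫_ℝ + ⟪z.1 - w.1, X.snd⟫_ℝ)
        * expi (-1 * ⟪X.fst - w.1, X.snd - z.2⟫_ℝ) := by
    simp only [← expi_add]
    congr 1
    simp only [inner_sub_left, inner_sub_right, real_inner_comm z.2 X.fst]
    ring
  linear_combination (h (X.fst - w.1) * conj (𝓕 g (X.snd - z.2))) * key

/-- Here the roles are exchanged: `g` enters in time and `ĥ` in frequency, so the position becomes
`(z.1, w.2)`. -/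
theorem conjRihaczek_tfShift (h g : 𝓢(Space d, ℂ)) (w z : Space d × Space d) :
    conjRihaczek (tfShift w.1 w.2 h) (tfShift z.1 z.2 g)
      = expi (⟪w.1, w.2⟫_ℝ - ⟪z.1, w.2⟫_ℝ) •
        tfShift (WithLp.toLp 2 (z.1, w.2) : PhaseSpace d) (WithLp.toLp 2 (w.2 - z.2, z.1 - w.1))
          (conjRihaczek h g) := by
  ext X
  rw [_root_.smul_apply, smul_eq_mul, tfShift_apply, conjRihaczek_apply, conjRihaczek_apply,
    tfShift_apply, fourier_tfShift_apply]
  simp only [chirp, map_mul, conj_expi, inner_phaseSpace, WithLp.sub_fst, WithLp.sub_snd,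
    WithLp.toLp_fst, WithLp.toLp_snd]
  have key : expi (1 * ⟪X.fst, X.snd⟫_ℝ) * expi (-⟪z.2, X.fst⟫_ℝ) * expi (-⟪w.1, X.snd - w.2⟫_ℝ)
      = expi (⟪w.1, w.2⟫_ℝ - ⟪z.1, w.2⟫_ℝ)
        * expi (⟪w.2 - z.2, X.fst⟫_ℝ + ⟪z.1 - w.1, X.snd⟫_ℝ)
        * expi (1 * ⟪X.fst - z.1, X.snd - w.2⟫_ℝ) := by
    simp only [← expi_add]
    congr 1
    simp only [inner_sub_left, inner_sub_right, real_inner_comm w.2 X.fst]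
    ring
  linear_combination (𝓕 h (X.snd - w.2) * conj (g (X.fst - z.1))) * key

variable {e : (Space d × Space d) ≃ₗᵢ[ℝ] (Space d × Space d)} {Φ : 𝓢(PhaseSpace d, ℂ)}
  {σ : 𝓢'(PhaseSpace d, ℂ)}

/-- The envelope of the symbol in the coordinates given by `e`. -/
def symbolEnvelope (e : (Space d × Space d) ≃ₗᵢ[ℝ] (Space d × Space d)) (Φ : 𝓢(PhaseSpace d, ℂ))
    (σ : 𝓢'(PhaseSpace d, ℂ)) (p : Space d × Space d) : ℝ≥0∞ :=
  envelope (Module.finrank ℝ (PhaseSpace d) + 1) Φ σ (WithLp.toLp 2 (e p))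

theorem measurable_symbolEnvelope : Measurable (symbolEnvelope e Φ σ) :=
  (measurable_envelope _ Φ σ).comp
    ((WithLp.volume_preserving_toLp (U := Space d) (V := Space d)).measurable.comp e.continuous.measurable)

theorem lintegral_symbolEnvelope_lt_top (he : MeasurePreserving e)
    (hσ : σ ∈ wienerAmalgamSpace Φ ∞ 1) : ∫⁻ p, symbolEnvelope e Φ σ p < ∞ := by
  have h := (WithLp.volume_preserving_toLp (U := Space d) (V := Space d)).comp he
  have h2 := h.lintegral_comp (measurable_envelope (Module.finrank ℝ (PhaseSpace d) + 1) Φ σ)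
  refine lt_of_eq_of_lt h2 ?_
  exact lintegral_envelope_lt_top (Nat.lt_succ_self _) hσ

theorem finrank_phaseSpace_lt : Module.finrank ℝ (Space d) <
    Module.finrank ℝ (PhaseSpace d) + 1 := by
  have h : Module.finrank ℝ (PhaseSpace d) = Module.finrank ℝ (Space d × Space d) :=
    (WithLp.linearEquiv 2 ℝ (Space d × Space d)).finrank_eq
  rw [h, Module.finrank_prod]
  omega

/-- The envelope is a convolution, so its restriction to a slice is controlled by integrating the
weight over the slice. That integral is bounded uniformly in the centre `y`, and `supStft` is
integrable in `y`. -/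
theorem lintegral_symbolEnvelope_zero_lt_top (hσ : σ ∈ wienerAmalgamSpace Φ ∞ 1) :
    ∫⁻ b, symbolEnvelope e Φ σ (0, b) < ∞ := by
  set N := Module.finrank ℝ (PhaseSpace d) + 1
  have hmeas : Measurable fun p : Space d × PhaseSpace d =>
      supStft Φ σ p.2 * decay N ((WithLp.toLp 2 (e (0, p.1)) : PhaseSpace d) - p.2) :=
    ((measurable_supStft Φ σ).comp measurable_snd).mul ((measurable_decay N).comp
      ((((WithLp.volume_preserving_toLp (U := Space d) (V := Space d)).measurable.comp e.continuous.measurable).comp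
        (measurable_const.prodMk measurable_fst)).sub measurable_snd))
  unfold symbolEnvelope envelope
  rw [lintegral_lintegral_swap hmeas.aemeasurable]
  have hbound : ∀ y : PhaseSpace d, ∫⁻ b : Space d,
      supStft Φ σ y * decay N ((WithLp.toLp 2 (e (0, b)) : PhaseSpace d) - y)
      ≤ supStft Φ σ y * ∫⁻ b : Space d, decay N b := by
    intro y
    have hm : Measurable fun b : Space d =>
        decay N ((WithLp.toLp 2 (e (0, b)) : PhaseSpace d) - y) :=
      (measurable_decay N).comp
        ((((WithLp.volume_preserving_toLp (U := Space d) (V := Space d)).measurable.comp e.continuous.measurable).comp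
          (measurable_const.prodMk measurable_id)).sub measurable_const)
    -- Recentre at the second coordinate of `y` read through `e⁻¹`; the distance along the slice is
    -- at most the distance in phase space.
    rw [lintegral_const_mul _ hm, ← lintegral_sub_right_eq_self (fun b : Space d => decay N b)
      (e.symm (WithLp.ofLp y)).2]
    gcongr with b
    refine decay_anti N ?_
    calc ‖b - (e.symm (WithLp.ofLp y)).2‖
        = ‖(e.symm (WithLp.ofLp ((WithLp.toLp 2 (e (0, b)) : PhaseSpace d) - y))).2‖ := by
          rw [WithLp.ofLp_sub, map_sub, Prod.snd_sub, e.symm_apply_apply]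
      _ ≤ ‖e.symm (WithLp.ofLp ((WithLp.toLp 2 (e (0, b)) : PhaseSpace d) - y))‖ :=
          norm_snd_le _
      _ ≤ _ := by
          rw [e.symm.norm_map]
          exact norm_ofLp_le _
  refine lt_of_le_of_lt (lintegral_mono hbound) ?_
  rw [lintegral_mul_const _ (measurable_supStft Φ σ)]
  exact ENNReal.mul_lt_top (lintegral_supStft_lt_top hσ)
    (lintegral_decay_lt_top finrank_phaseSpace_lt)

theorem enorm_bracket_smul_tfShift (f : 𝓢'(PhaseSpace d, ℂ)) (s : ℝ) (X Ω : PhaseSpace d)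
    (Ψ : 𝓢(PhaseSpace d, ℂ)) :
    ‖bracket f (expi s • tfShift X Ω Ψ)‖ₑ = ‖stft Ψ f X Ω‖ₑ := by
  rw [bracket_smul, enorm_mul, conj_expi, ← ofReal_norm, norm_expi, ENNReal.ofReal_one, one_mul,
    stft]

/-- Operators whose kernels are short-time Fourier transforms of a symbol in
`W(𝓕L^∞, L^1)` have dominated kernels. -/
theorem hasDominatedKernel_of_symbol (he : MeasurePreserving e) (hΦ : Φ ≠ 0)
    (hσ : σ ∈ wienerAmalgamSpace Φ ∞ 1) {A : 𝓢(Space d, ℂ) → 𝓢'(Space d, ℂ)}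
    (hclm : ∀ h : 𝓢(Space d, ℂ), ∃ B : 𝓢(Space d, ℂ) →L[ℂ] ℂ, ∀ ψ, bracket (A ψ) h = B ψ)
    {R : 𝓢(Space d, ℂ) → 𝓢(Space d, ℂ) →L[ℂ] 𝓢(PhaseSpace d, ℂ)}
    (hR : ∀ (g h : 𝓢(Space d, ℂ)) (p q : Space d × Space d), ∃ Ω : PhaseSpace d,
      ‖bracket (A (tfShift (e q).1 (e q).2 g)) (tfShift (e p).1 (e p).2 h)‖ₑ
        = ‖stft (R g h) σ (WithLp.toLp 2 (e (p.1, q.2))) Ω‖ₑ) :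
    HasDominatedKernel A e (symbolEnvelope e Φ σ) where
  measurable := measurable_symbolEnvelope
  lintegral_lt_top := lintegral_symbolEnvelope_lt_top he hσ
  lintegral_zero_lt_top := lintegral_symbolEnvelope_zero_lt_top hσ
  exists_clm := hclm
  exists_bound g := by
    set N := Module.finrank ℝ (PhaseSpace d) + 1
    obtain ⟨C, -, hC⟩ := exists_enorm_stft_le_envelope (N := N) (Nat.lt_succ_self _) hΦ
    -- Continuity and vanishing at `0` of this choice of `Q` come from `R g` being continuous and
    -- linear in the test function.
    refine ⟨fun h => C * windowSize (N + N) (R g h),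
      continuous_const.mul ((continuous_windowSize _).comp (R g).continuous), ?_, fun h p q => ?_⟩
    · simp only [map_zero, windowSize_zero, mul_zero]
    · obtain ⟨Ω, hΩ⟩ := hR g h p q
      rw [hΩ]
      exact hC (R g h) σ _ Ω

theorem hasDominatedKernel_opKN (hΦ : Φ ≠ 0) (hσ : σ ∈ wienerAmalgamSpace Φ ∞ 1) :
    HasDominatedKernel (opKN σ) (LinearIsometryEquiv.refl ℝ (Space d × Space d))
      (symbolEnvelope (LinearIsometryEquiv.refl ℝ _) Φ σ) := by
  refine hasDominatedKernel_of_symbol (MeasurePreserving.id _) hΦ hσ (fun h => ?_)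
    (R := fun g => SchwartzMap.smulLeftCLM ℂ (chirp (-1)) ∘L tensorRight (conjS (𝓕 g)))
    fun g h p q => ⟨WithLp.toLp 2 (p.2 - q.2, q.1 - p.1), ?_⟩
  · exact ⟨(show 𝓢(PhaseSpace d, ℂ) →L[ℂ] ℂ from σ) ∘L SchwartzMap.smulLeftCLM ℂ (chirp 1) ∘L
      tensorLeft (conjS h) ∘L fourierCLM ℂ 𝓢(Space d, ℂ), fun ψ => rfl⟩
  · rw [bracket_opKN, LinearIsometryEquiv.coe_refl, id, id, rihaczek_tfShift,
      enorm_bracket_smul_tfShift]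
    rfl

/-- The exchange of the two components of a product as a linear isometry. -/
def swapIsometry (d : ℕ) : (Space d × Space d) ≃ₗᵢ[ℝ] (Space d × Space d) :=
  ⟨LinearEquiv.prodComm ℝ (Space d) (Space d), fun _ => max_comm _ _⟩

theorem swapIsometry_apply (p : Space d × Space d) : swapIsometry d p = (p.2, p.1) := rfl

theorem measurePreserving_swapIsometry : MeasurePreserving (swapIsometry d) :=
  Measure.measurePreserving_swap (μ := (volume : Measure (Space d))) (ν := volume)

/-- In swapped coordinates `p.1` is the frequency of the test shift and `q.2` the time of the input
shift, so the point `(z.1, w.2)` equals `(q.2, p.1) = swapIsometry d (p.1, q.2)`. -/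
theorem hasDominatedKernel_opAntiKN (hΦ : Φ ≠ 0) (hσ : σ ∈ wienerAmalgamSpace Φ ∞ 1) :
    HasDominatedKernel (opAntiKN σ) (swapIsometry d) (symbolEnvelope (swapIsometry d) Φ σ) := by
  refine hasDominatedKernel_of_symbol measurePreserving_swapIsometry hΦ hσ (fun h => ?_)
    (R := fun g => SchwartzMap.smulLeftCLM ℂ (chirp 1) ∘L tensorLeft (conjS g) ∘L
      fourierCLM ℂ 𝓢(Space d, ℂ))
    fun g h p q => ⟨WithLp.toLp 2 (p.1 - q.1, q.2 - p.2), ?_⟩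
  · exact ⟨(show 𝓢(PhaseSpace d, ℂ) →L[ℂ] ℂ from σ) ∘L SchwartzMap.smulLeftCLM ℂ (chirp (-1)) ∘L
      tensorRight (𝓕⁻ (conjS h)), fun ψ => rfl⟩
  · rw [bracket_opAntiKN, swapIsometry_apply, swapIsometry_apply, conjRihaczek_tfShift,
      enorm_bracket_smul_tfShift]
    rfl

end Symbol

end TimeFrequency

end

theorem mainTheorem8 (d : ℕ)
    (Φ : 𝓢(TimeFrequency.PhaseSpace d, ℂ)) (hΦ : Φ ≠ 0)
    (φ : 𝓢(TimeFrequency.Space d, ℂ)) (hφ : φ ≠ 0)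
    (σ : 𝓢'(TimeFrequency.PhaseSpace d, ℂ))
    (hσ : σ ∈ TimeFrequency.wienerAmalgamSpace Φ ∞ 1) :
    (∃ T : 𝓢'(TimeFrequency.Space d, ℂ) → 𝓢'(TimeFrequency.Space d, ℂ),
      TimeFrequency.IsBoundedOperator (TimeFrequency.opKN σ)
        (TimeFrequency.modulationNorm φ 1 ∞) T) ∧
    (∃ T : 𝓢'(TimeFrequency.Space d, ℂ) → 𝓢'(TimeFrequency.Space d, ℂ),
      TimeFrequency.IsBoundedOperator (TimeFrequency.opAntiKN σ)
        (TimeFrequency.wienerAmalgamNorm φ 1 ∞) T) :=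
  -- The modulation and amalgam norms agree definitionally with `mixedNorm` for the identity and for
  -- the swap.
  ⟨⟨_, (TimeFrequency.hasDominatedKernel_opKN hΦ hσ).isBoundedOperator
      (MeasureTheory.MeasurePreserving.id _) hφ⟩,
    ⟨_, (TimeFrequency.hasDominatedKernel_opAntiKN hΦ hσ).isBoundedOperator
      TimeFrequency.measurePreserving_swapIsometry hφ⟩⟩
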